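/- A convex $3$-polytope is a bounded set $P=\{x\in\mathbb R^3: \langle a_i,x\rangle+b_i\ge 0,\ i=1,\dots,m\}$ with nonempty interior, where no inequality can be deleted without changing the set. Its facets are $F_i=P\cap\{x:\langle a_i,x\rangle+b_i=0\}$, its faces are the intersections of facets, its vertices and edges are its faces of dimension $0$ and $1$, and a facet is a $k$-gon if it contains exactly $k$ edges. $P$ is simple if every vertex lies in exactly three facets. A $k$-belt of a simple $3$-polytope is a cyclic sequence of facets $(F_{i_1},\dots,F_{i_k})$ (considered up to the choice of the starting point and of the direction) such that $F_{i_1}\cap F_{i_2},\dots,F_{i_{k-1}}\cap F_{i_k},F_{i_k}\cap F_{i_1}$ are edges, $F_{i_1}\cap\dots\cap F_{i_k}=\varnothing$, and, for $p\ne q$, $F_{i_p}\cap F_{i_q}\neq\varnothing$ if and only if $\{p,q\}\in\{\{1,2\},\dots,\{k-1,k\},\{k,1\}\}$. It surrounds a facet $F$ if $F\cap F_{i_1},\dots,F\cap F_{i_k}$ are the edges of $F$, each listed once, in the cyclic order in which they occur along the boundary of $F$. **Theorem.** Let $P$ be a simple convex $3$-polytope all of whose facets are pentagons and hexagons, with at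 most one exceptional facet, which is a quadrangle or a heptagon. 1. If $P$ has no quadrangle, then $P$ has no $4$-belts. 2. If $P$ has a quadrangle $F$, then $P$ has exactly one $4$-belt, and this belt surrounds $F$. In particular, fullerenes (simple convex $3$-polytopes all of whose facets are pentagons and hexagons) have no $4$-belts. -/

import Mathlib

/-- An `n`-dimensional convex polytope in `ℝⁿ`: a bounded set with nonempty interior, given by an
irredundant system of `m` inequalities `⟨aᵢ, x⟩ + bᵢ ≥ 0` (deleting any of them changes the set). -/
structure ConvexPolytope (n : ℕ) where
  m : ℕ
  a : Fin m → EuclideanSpace ℝ (Fin n)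
  b : Fin m → ℝ
  bounded : Bornology.IsBounded {x : EuclideanSpace ℝ (Fin n) | ∀ i, 0 ≤ inner ℝ (a i) x + b i}
  irredundant : ∀ i, {x : EuclideanSpace ℝ (Fin n) | ∀ j, j ≠ i → 0 ≤ inner ℝ (a j) x + b j} ≠
    {x : EuclideanSpace ℝ (Fin n) | ∀ j, 0 ≤ inner ℝ (a j) x + b j}
  fullDim : (interior
    {x : EuclideanSpace ℝ (Fin n) | ∀ i, 0 ≤ inner ℝ (a i) x + b i}).Nonempty

namespace ConvexPolytope

/-- The underlying point set of the polytope. -/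
def carrier {n : ℕ} (P : ConvexPolytope n) : Set (EuclideanSpace ℝ (Fin n)) :=
  {x | ∀ i, 0 ≤ inner ℝ (P.a i) x + P.b i}

/-- The `i`-th facet: the part of the polytope in the `i`-th hyperplane. Irredundancy makes
different indices give different facets, so facets are referred to by their indices. -/
def facet {n : ℕ} (P : ConvexPolytope n) (i : Fin P.m) : Set (EuclideanSpace ℝ (Fin n)) :=
  {x | x ∈ P.carrier ∧ inner ℝ (P.a i) x + P.b i = 0}

/-- A face is an intersection of facets (the empty intersection being the polytope itself). -/
def IsFace {n : ℕ} (P : ConvexPolytope n) (G : Set (EuclideanSpace ℝ (Fin n))) : Prop :=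
  ∃ S : Finset (Fin P.m), G = P.carrier ∩ ⋂ i ∈ S, P.facet i

/-- A vertex is a point that is a face. -/
def IsVertex {n : ℕ} (P : ConvexPolytope n) (v : EuclideanSpace ℝ (Fin n)) : Prop :=
  P.IsFace {v}

/-- An edge is a face of dimension one. -/
def IsEdge {n : ℕ} (P : ConvexPolytope n) (G : Set (EuclideanSpace ℝ (Fin n))) : Prop :=
  P.IsFace G ∧ Module.finrank ℝ (vectorSpan ℝ G) = 1

/-- An `n`-polytope is simple if each of its vertices lies in exactly `n` facets. -/
def IsSimple {n : ℕ} (P : ConvexPolytope n) : Prop :=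
  ∀ v, P.IsVertex v → {i | v ∈ P.facet i}.ncard = n

/-- The edges of a facet of a `3`-polytope: the edges of the polytope contained in it. -/
def edgesOf (P : ConvexPolytope 3) (i : Fin P.m) : Set (Set (EuclideanSpace ℝ (Fin 3))) :=
  {G | P.IsEdge G ∧ G ⊆ P.facet i}

/-- The `i`-th facet is a `k`-gon. -/
def IsGon (P : ConvexPolytope 3) (k : ℕ) (i : Fin P.m) : Prop :=
  (P.edgesOf i).ncard = k

/-- A `k`-loop: a cyclic sequence of `k` facets such that successive ones meet in an edge. -/
def IsLoop (P : ConvexPolytope 3) {k : ℕ} (B : ZMod k → Fin P.m) : Prop :=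
  ∀ j, P.IsEdge (P.facet (B j) ∩ P.facet (B (j + 1)))

/-- A `k`-belt: a `k`-loop whose facets have no point common to all of them, and in which two
facets at different positions intersect if and only if the positions are successive. -/
def IsBelt (P : ConvexPolytope 3) {k : ℕ} (B : ZMod k → Fin P.m) : Prop :=
  P.IsLoop B ∧ (⋂ j, P.facet (B j)) = ∅ ∧
    ∀ p q, p ≠ q → ((P.facet (B p) ∩ P.facet (B q)).Nonempty ↔ q = p + 1 ∨ p = q + 1)

/-- The cyclic sequence `B` of `k` facets surrounds the facet `i`: it lists the facets met when
walking once along the boundary of the facet `i`, on the other side. That is, the sets `Fᵢ ∩ B j`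
are all the edges of `Fᵢ`, each listed once, and successive edges share a vertex. -/
def Surrounds (P : ConvexPolytope 3) {k : ℕ} (B : ZMod k → Fin P.m) (i : Fin P.m) : Prop :=
  Function.Injective (fun j => P.facet i ∩ P.facet (B j)) ∧
    Set.range (fun j => P.facet i ∩ P.facet (B j)) = P.edgesOf i ∧
    ∀ j, (P.facet i ∩ P.facet (B j) ∩ P.facet (B (j + 1))).Nonempty

/-- All facets are pentagons and hexagons, except at most one, a quadrangle or a heptagon. -/
def PentHexWithException (P : ConvexPolytope 3) : Prop :=
  (∀ i, P.IsGon 4 i ∨ P.IsGon 5 i ∨ P.IsGon 6 i ∨ P.IsGon 7 i) ∧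
    ∀ i j, (P.IsGon 4 i ∨ P.IsGon 7 i) → (P.IsGon 4 j ∨ P.IsGon 7 j) → i = j

/-- A (combinatorial) fullerene: a simple `3`-polytope with all facets pentagons and hexagons. -/
def IsFullerene (P : ConvexPolytope 3) : Prop :=
  P.IsSimple ∧ ∀ i, P.IsGon 5 i ∨ P.IsGon 6 i

end ConvexPolytope

/-- Two indexed sequences are the same cyclic sequence: they agree up to the choice of the
starting point and of the direction of traversal. -/
def SameCyclic {k : ℕ} {α : Type*} (B C : ZMod k → α) : Prop :=
  (∃ s, ∀ j, C j = B (s + j)) ∨ ∃ s, ∀ j, C j = B (s - j)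

/-!
A simple `3`-polytope is encoded by the family of its vertices, a vertex being the triple of the
facets through it. For a generic linear functional every vertex is the highest or the lowest one of
some facet, and counting facets by their extreme vertices gives `f₀ + 4 ≤ 2 f₂`, half of Euler's
formula. It makes the complex of vertices, edges and facets modulo `2` exact, which is the Jordan
curve theorem in dual form: a closed path of adjacent facets crosses exactly the edges between some
set of vertices and its complement. The same linear algebra, applied to a set of vertices with few
outgoing edges, gives Euler's formula for this set.

A `k`-belt, `k = 3, 4`, separates the vertices into two sides. Let the weight of a side be its
number of incidences with the facets of the belt. As only one facet can have more than six vertices,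
the two weights add up to at most `6k + 1`, and to at most `6k` if the exceptional facet is not in
the belt. On the other hand, by Euler's formula, and since no facet but one has fewer than five
vertices, a side of weight at most `9` (for `k = 3`) or `12` (for `k = 4`) can be replaced by its
core, the set of its vertices off the belt, which is smaller and is again a side of a `k`-belt, of
no larger weight if all inner facets have at most six vertices. The only obstruction is an empty
core, and then `k = 4` and the side consists of the vertices of a quadrangle. So the two weights are
too large unless the belt surrounds a quadrangle.
-/

open Finset

theorem nodup_four_iff {α : Type*} {a b c d : α} : [a, b, c, d].Nodup ↔
    a ≠ b ∧ a ≠ c ∧ a ≠ d ∧ b ≠ c ∧ b ≠ d ∧ c ≠ d := by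
  grind

theorem nodup_four_rotate {α : Type*} {a b c d : α} (h : [a, b, c, d].Nodup) :
    [b, c, d, a].Nodup := by
  grind

section EvenGraph

variable {ι : Type*} [DecidableEq ι] {C T : Finset (Finset ι)} {S : Finset ι} {a b c d : ι}

/-- A finite set of edges (pairs of vertices) in which every vertex has even degree, that is, a
cycle modulo `2`. -/
structure IsEvenGraph (C : Finset (Finset ι)) : Prop where
  card_eq : ∀ e ∈ C, #e = 2
  even : ∀ i, Even #{e ∈ C | i ∈ e}

/-- The edge set of the quadrilateral with successive vertices `a`, `b`, `c`, `d`. -/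
def fourCycle (a b c d : ι) : Finset (Finset ι) := {{a, b}, {b, c}, {c, d}, {d, a}}

theorem pair_eq_pair_iff_eq_or_swap :
    ({a, b} : Finset ι) = {c, d} ↔ a = c ∧ b = d ∨ a = d ∧ b = c := by
  rw [← coe_inj, coe_pair, coe_pair, Set.pair_eq_pair_iff]

theorem fourCycle_rotate (a b c d : ι) : fourCycle b c d a = fourCycle a b c d := by
  grind [fourCycle]

theorem exists_mem_fourCycle_iff {x : ι} :
    (∃ e ∈ fourCycle a b c d, x ∈ e) ↔ x ∈ ({a, b, c, d} : Finset ι) := by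
  simp only [fourCycle, mem_insert, mem_singleton, exists_eq_or_imp, exists_eq_left]
  tauto

theorem card_fourCycle (h : [a, b, c, d].Nodup) : #(fourCycle a b c d) = 4 := by
  rw [nodup_four_iff] at h
  rw [fourCycle, card_insert_of_notMem, card_insert_of_notMem, card_insert_of_notMem,
    card_singleton] <;>
  simp only [mem_insert, mem_singleton, pair_eq_pair_iff_eq_or_swap] <;> tauto

theorem card_fourCycle_filter_mem (h : [a, b, c, d].Nodup) :
    #{e ∈ fourCycle a b c d | a ∈ e} = 2 := by
  rw [nodup_four_iff] at h
  obtain ⟨hab, hac, had, -, hbd, -⟩ := h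
  have hfilter : {e ∈ fourCycle a b c d | a ∈ e} = {{a, b}, {d, a}} := by
    simp [fourCycle, filter_insert, filter_singleton, hab, hac, had]
  rw [hfilter, card_pair]
  simp only [ne_eq, pair_eq_pair_iff_eq_or_swap]
  tauto

theorem isEvenGraph_fourCycle (h : [a, b, c, d].Nodup) : IsEvenGraph (fourCycle a b c d) := by
  have heven {a b c d : ι} (h : [a, b, c, d].Nodup) : Even #{e ∈ fourCycle a b c d | a ∈ e} :=
    card_fourCycle_filter_mem h ▸ even_two
  refine ⟨?_, fun i => ?_⟩
  · rw [nodup_four_iff] at h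
    simp only [fourCycle, mem_insert, mem_singleton]
    rintro e (rfl | rfl | rfl | rfl) <;> apply card_pair <;> tauto
  · by_cases hi : i ∈ ({a, b, c, d} : Finset ι)
    · have h' := nodup_four_rotate h
      have h'' := nodup_four_rotate h'
      simp only [mem_insert, mem_singleton] at hi
      rcases hi with rfl | rfl | rfl | rfl
      · exact heven h
      · exact fourCycle_rotate a i c d ▸ heven h'
      · exact fourCycle_rotate a b i d ▸ fourCycle_rotate b i d a ▸ heven h''
      · exact fourCycle_rotate i a b c ▸ heven (nodup_four_rotate h'')
    · rw [filter_false_of_mem, card_empty]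
      · exact Even.zero
      · simp only [fourCycle, mem_insert, mem_singleton] at hi ⊢
        grind

theorem card_powersetCard_two_filter_mem (hS : #S = 3) {i : ι} (hi : i ∈ S) :
    #{e ∈ powersetCard 2 S | i ∈ e} = 2 := by
  have hnot : {e ∈ powersetCard 2 S | i ∉ e} = powersetCard 2 (S.erase i) := by
    ext e
    simp only [mem_filter, mem_powersetCard, subset_erase]
    tauto
  have hsplit := card_filter_add_card_filter_not (s := powersetCard 2 S) (i ∈ ·)
  rw [hnot, card_powersetCard, card_powersetCard, card_erase_of_mem hi, hS] at hsplit
  simpa using hsplit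

theorem powersetCard_two_triple_subset (hab : {a, b} ∈ C) (hbc : {b, c} ∈ C) (hca : {c, a} ∈ C) :
    powersetCard 2 {a, b, c} ⊆ C := by
  intro e he
  obtain ⟨hsub, hcard⟩ := mem_powersetCard.1 he
  obtain ⟨x, y, hxy, rfl⟩ := card_eq_two.1 hcard
  simp only [insert_subset_iff, singleton_subset_iff, mem_insert, mem_singleton] at hsub
  grind [pair_comm]

theorem isEvenGraph_powersetCard_two (hS : #S = 3) : IsEvenGraph (powersetCard 2 S) := by
  refine ⟨fun e he => (mem_powersetCard.1 he).2, fun i => ?_⟩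
  by_cases hi : i ∈ S
  · rw [card_powersetCard_two_filter_mem hS hi]
    exact even_two
  · rw [filter_false_of_mem fun e he hie => hi ((mem_powersetCard.1 he).1 hie)]
    exact Even.zero

namespace IsEvenGraph

theorem sdiff (hC : IsEvenGraph C) (hT : IsEvenGraph T) (hTC : T ⊆ C) : IsEvenGraph (C \ T) := by
  refine ⟨fun e he => hC.card_eq e (mem_sdiff.1 he).1, fun i => ?_⟩
  have hfilter : {e ∈ C \ T | i ∈ e} = {e ∈ C | i ∈ e} \ {e ∈ T | i ∈ e} := by grind
  have hle : #{e ∈ T | i ∈ e} ≤ #{e ∈ C | i ∈ e} := card_le_card (filter_subset_filter _ hTC)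
  rw [hfilter, card_sdiff_of_subset (filter_subset_filter _ hTC), Nat.even_sub hle]
  simp only [hC.even i, hT.even i]

theorem exists_next (hC : IsEvenGraph C) (hab : {a, b} ∈ C) :
    ∃ c, c ≠ a ∧ c ≠ b ∧ {b, c} ∈ C := by
  have hone : 1 < #{e ∈ C | b ∈ e} := by
    have hpos : 0 < #{e ∈ C | b ∈ e} := card_pos.2 ⟨{a, b}, by simp [hab]⟩
    obtain ⟨r, hr⟩ := hC.even b
    omega
  obtain ⟨e, he, hne⟩ := exists_mem_ne hone {a, b}
  obtain ⟨heC, hbe⟩ := mem_filter.1 he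
  obtain ⟨x, y, hxy, rfl⟩ := card_eq_two.1 (hC.card_eq e heC)
  rcases mem_insert.1 hbe with rfl | hby
  · exact ⟨y, fun h => hne (by rw [h, pair_comm]), hxy.symm, heC⟩
  · rw [mem_singleton] at hby
    subst hby
    exact ⟨x, fun h => hne (by rw [h]), hxy, pair_comm x b ▸ heC⟩

theorem exists_path (hC : IsEvenGraph C) (hne : C.Nonempty) :
    ∃ a b c d, a ≠ b ∧ c ≠ a ∧ c ≠ b ∧ d ≠ b ∧ d ≠ c ∧ {{a, b}, {b, c}, {c, d}} ⊆ C ∧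
      #({{a, b}, {b, c}, {c, d}} : Finset (Finset ι)) = 3 := by
  obtain ⟨e, he⟩ := hne
  obtain ⟨a, b, hab, rfl⟩ := card_eq_two.1 (hC.card_eq e he)
  obtain ⟨c, hca, hcb, hbc⟩ := hC.exists_next he
  obtain ⟨d, hdb, hdc, hcd⟩ := hC.exists_next hbc
  refine ⟨a, b, c, d, hab, hca, hcb, hdb, hdc, by simp [insert_subset_iff, he, hbc, hcd], ?_⟩
  rw [card_insert_of_notMem, card_insert_of_notMem, card_singleton] <;>
  simp only [mem_insert, mem_singleton, pair_eq_pair_iff_eq_or_swap] <;> grind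

theorem three_le_card (hC : IsEvenGraph C) (hne : C.Nonempty) : 3 ≤ #C := by
  obtain ⟨a, b, c, d, -, -, -, -, -, hsub, hcard⟩ := hC.exists_path hne
  exact hcard ▸ card_le_card hsub

theorem exists_eq_powersetCard_two (hC : IsEvenGraph C) (h3 : #C = 3) :
    ∃ S, #S = 3 ∧ C = powersetCard 2 S := by
  obtain ⟨a, b, c, d, hab, hca, hcb, -, -, hsub, hcard⟩ :=
    hC.exists_path (card_pos.1 (by omega))
  have hCeq := eq_of_subset_of_card_le hsub (by omega)
  obtain ⟨x, hxb, hxa, hax⟩ := hC.exists_next (pair_comm a b ▸ hsub (by simp : {a, b} ∈ _))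
  have hda : d = a := by
    simp only [← hCeq, mem_insert, mem_singleton, pair_eq_pair_iff_eq_or_swap] at hax
    grind
  subst hda
  have hS : #{d, b, c} = 3 := card_eq_three.2 ⟨d, b, c, hab, hca.symm, hcb.symm, rfl⟩
  refine ⟨{d, b, c}, hS, eq_of_subset_of_card_le (fun e he => ?_) ?_⟩
  · refine mem_powersetCard.2 ⟨?_, hC.card_eq e he⟩
    simp only [← hCeq, mem_insert, mem_singleton] at he
    grind
  · rw [card_powersetCard, hS, h3]; decide

theorem not_powersetCard_two_subset (hC : IsEvenGraph C) (h4 : #C = 4) (hS : #S = 3) :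
    ¬ powersetCard 2 S ⊆ C := by
  intro hsub
  have hcard : #(C \ powersetCard 2 S) = 1 := by
    rw [card_sdiff_of_subset hsub, card_powersetCard, hS, h4]; decide
  have := (hC.sdiff (isEvenGraph_powersetCard_two hS) hsub).three_le_card (card_pos.1 (by omega))
  omega

theorem exists_eq_fourCycle (hC : IsEvenGraph C) (h4 : #C = 4) :
    ∃ a b c d, [a, b, c, d].Nodup ∧ C = fourCycle a b c d := by
  obtain ⟨a, b, c, d, hab, hca, hcb, hdb, hdc, hsub, -⟩ := hC.exists_path (card_pos.1 (by omega))
  simp only [insert_subset_iff, singleton_subset_iff] at hsub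
  obtain ⟨habC, hbcC, hcdC⟩ := hsub
  have htriangle {x y z : ι} (hxy : x ≠ y) (hyz : y ≠ z) (hzx : z ≠ x) (hxyC : {x, y} ∈ C)
      (hyzC : {y, z} ∈ C) : {z, x} ∉ C := fun hzxC =>
    hC.not_powersetCard_two_subset h4 (card_eq_three.2 ⟨x, y, z, hxy, hzx.symm, hyz, rfl⟩)
      (powersetCard_two_triple_subset hxyC hyzC hzxC)
  have hda : d ≠ a := by
    rintro rfl
    exact htriangle hab hcb.symm hca habC hbcC hcdC
  obtain ⟨x, hxc, hxd, hdx⟩ := hC.exists_next hcdC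
  have hxb : x ≠ b := by
    rintro rfl
    exact htriangle hcb.symm hdc.symm hdb hbcC hcdC hdx
  have hCeq : {{a, b}, {b, c}, {c, d}, {d, x}} = C := by
    refine eq_of_subset_of_card_le ?_ ?_
    · simp only [insert_subset_iff, singleton_subset_iff]
      exact ⟨habC, hbcC, hcdC, hdx⟩
    · rw [h4, card_insert_of_notMem, card_insert_of_notMem, card_insert_of_notMem,
        card_singleton] <;>
      simp only [mem_insert, mem_singleton, pair_eq_pair_iff_eq_or_swap] <;> grind
  obtain ⟨y, hyb, hya, hay⟩ := hC.exists_next (pair_comm a b ▸ habC)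
  have hxa : x = a := by
    simp only [← hCeq, mem_insert, mem_singleton, pair_eq_pair_iff_eq_or_swap] at hay
    grind
  exact ⟨a, b, c, d, nodup_four_iff.2 ⟨hab, hca.symm, hda.symm, hcb.symm, hdb.symm, hdc.symm⟩,
    by rw [← hCeq, hxa, fourCycle]⟩

end IsEvenGraph

end EvenGraph

section ModTwoComplex

variable {α β γ : Type*} {A : Finset α} {E : Finset β} {D : Finset γ}

/-- The mod `2` incidence matrix of the relation `R`, with rows indexed by `E` and columns indexed
by `A`. -/
def incidenceMatrix (E : Finset β) (A : Finset α) (R : β → α → Prop) [DecidableRel R] :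
    Matrix E A (ZMod 2) :=
  Matrix.of fun e a => if R e a then 1 else 0

theorem transpose_incidenceMatrix (R : β → α → Prop) [DecidableRel R] :
    (incidenceMatrix E A R).transpose = incidenceMatrix A E (fun a e => R e a) :=
  rfl

theorem exists_eq_indicator [DecidableEq α] (x : A → ZMod 2) :
    ∃ T ⊆ A, x = fun a : A => if (a : α) ∈ T then 1 else 0 := by
  refine ⟨({a | x a = 1} : Finset A).map (Function.Embedding.subtype _), ?_, ?_⟩
  · intro a ha
    obtain ⟨b, -, rfl⟩ := mem_map.1 ha
    exact b.2
  · funext a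
    have hbit : ∀ z : ZMod 2, z = if z = 1 then 1 else 0 := by decide
    simpa using hbit (x a)

theorem incidenceMatrix_mulVec_indicator [DecidableEq α] (R : β → α → Prop) [DecidableRel R]
    {T : Finset α} (hT : T ⊆ A) (e : E) :
    (incidenceMatrix E A R).mulVec (fun a => if (a : α) ∈ T then 1 else 0) e =
      (#{a ∈ T | R e a} : ZMod 2) := by
  have hfilter : {a ∈ A | R e a ∧ a ∈ T} = {a ∈ T | R e a} := by
    ext a
    simp only [mem_filter]
    exact ⟨fun h => ⟨h.2.2, h.2.1⟩, fun h => ⟨hT h.1, h.2, h.1⟩⟩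
  simp only [Matrix.mulVec, dotProduct, incidenceMatrix, Matrix.of_apply, ← ite_and, mul_ite,
    mul_one, mul_zero, and_comm]
  rw [sum_coe_sort A (fun a => if R e a ∧ a ∈ T then (1 : ZMod 2) else 0), sum_boole, hfilter]

theorem incidenceMatrix_mul_eq_zero {R : β → α → Prop} [DecidableRel R] {S : γ → β → Prop}
    [DecidableRel S] (hRS : ∀ a ∈ A, ∀ i ∈ D, Even #{e ∈ E | S i e ∧ R e a}) :
    incidenceMatrix D E S * incidenceMatrix E A R = 0 := by
  ext i a
  simp only [Matrix.mul_apply, incidenceMatrix, Matrix.of_apply, Matrix.zero_apply, mul_ite,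
    mul_one, mul_zero, ← ite_and]
  rw [sum_coe_sort E (fun e => if R e a ∧ S i e then (1 : ZMod 2) else 0), sum_boole,
    ZMod.natCast_eq_zero_iff_even]
  simpa only [and_comm] using hRS a a.2 i i.2

theorem card_le_rank_incidenceMatrix_add_one {R : β → α → Prop} [DecidableRel R]
    (hA : ∀ T ⊆ A, (∀ e ∈ E, Even #{a ∈ T | R e a}) → T = ∅ ∨ T = A) :
    #A ≤ (incidenceMatrix E A R).rank + 1 := by
  classical
  have hrank := LinearMap.finrank_range_add_finrank_ker (incidenceMatrix E A R).mulVecLin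
  rw [Module.finrank_pi, Fintype.card_coe] at hrank
  have hker : LinearMap.ker (incidenceMatrix E A R).mulVecLin ≤ Submodule.span (ZMod 2) {1} := by
    intro x hx
    obtain ⟨T, hTA, rfl⟩ := exists_eq_indicator x
    rw [LinearMap.mem_ker, Matrix.mulVecLin_apply] at hx
    have heven : ∀ e ∈ E, Even #{a ∈ T | R e a} := fun e he => by
      rw [← ZMod.natCast_eq_zero_iff_even, ← incidenceMatrix_mulVec_indicator R hTA ⟨e, he⟩, hx,
        Pi.zero_apply]
    rcases hA T hTA heven with rfl | rfl
    · convert Submodule.zero_mem _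
      simp
    · convert Submodule.mem_span_singleton_self _
      simp
  have hle := (Submodule.finrank_mono hker).trans (finrank_span_le_card _)
  rw [Set.toFinset_singleton, card_singleton] at hle
  rw [Matrix.rank]
  omega

theorem card_le_rank_incidenceMatrix {R : β → α → Prop} [DecidableRel R]
    (hA : ∀ T ⊆ A, (∀ e ∈ E, Even #{a ∈ T | R e a}) → T = ∅) :
    #A ≤ (incidenceMatrix E A R).rank := by
  classical
  have hrank := LinearMap.finrank_range_add_finrank_ker (incidenceMatrix E A R).mulVecLin
  rw [Module.finrank_pi, Fintype.card_coe] at hrank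
  have hker : LinearMap.ker (incidenceMatrix E A R).mulVecLin = ⊥ := by
    refine LinearMap.ker_eq_bot'.2 fun x hx => ?_
    obtain ⟨T, hTA, rfl⟩ := exists_eq_indicator x
    have heven : ∀ e ∈ E, Even #{a ∈ T | R e a} := fun e he => by
      rw [← ZMod.natCast_eq_zero_iff_even, ← incidenceMatrix_mulVec_indicator R hTA ⟨e, he⟩,
        ← Matrix.mulVecLin_apply, hx, Pi.zero_apply]
    rw [hA T hTA heven]
    ext a
    simp
  rw [hker, finrank_bot] at hrank
  rw [Matrix.rank]
  omega

/-- The Euler characteristic of a complex `A → E → D` modulo `2` with at most one-dimensional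
kernel at `A` and surjective second map is at most one. -/
theorem card_add_card_le_card_add_one {R : β → α → Prop} [DecidableRel R] {S : γ → β → Prop}
    [DecidableRel S]
    (hRS : ∀ a ∈ A, ∀ i ∈ D, Even #{e ∈ E | S i e ∧ R e a})
    (hA : ∀ T ⊆ A, (∀ e ∈ E, Even #{a ∈ T | R e a}) → T = ∅ ∨ T = A)
    (hD : ∀ J ⊆ D, (∀ e ∈ E, Even #{i ∈ J | S i e}) → J = ∅) : #A + #D ≤ #E + 1 := by
  have hrank := Matrix.rank_add_rank_le_card_of_mul_eq_zero (incidenceMatrix_mul_eq_zero hRS)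
  have hrankA := card_le_rank_incidenceMatrix_add_one hA
  have hrankD := card_le_rank_incidenceMatrix (R := fun e i => S i e) hD
  rw [← transpose_incidenceMatrix, Matrix.rank_transpose] at hrankD
  rw [Fintype.card_coe] at hrank
  omega

/-- A complex `A → E → D` modulo `2` with at most one-dimensional kernel and cokernel and Euler
characteristic at least two is exact at `E`. -/
theorem exists_odd_iff_mem_of_forall_even {R : β → α → Prop} [DecidableRel R] {S : γ → β → Prop}
    [DecidableRel S]
    (hRS : ∀ a ∈ A, ∀ i ∈ D, Even #{e ∈ E | S i e ∧ R e a})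
    (hA : ∀ T ⊆ A, (∀ e ∈ E, Even #{a ∈ T | R e a}) → T = ∅ ∨ T = A)
    (hD : ∀ J ⊆ D, (∀ e ∈ E, Even #{i ∈ J | S i e}) → J = ∅ ∨ J = D)
    (hcard : #E + 2 ≤ #A + #D) {C : Finset β} (hCE : C ⊆ E)
    (hC : ∀ i ∈ D, Even #{e ∈ C | S i e}) :
    ∃ T ⊆ A, ∀ e ∈ E, e ∈ C ↔ Odd #{a ∈ T | R e a} := by
  classical
  have hmul := incidenceMatrix_mul_eq_zero hRS
  have hrankA := card_le_rank_incidenceMatrix_add_one hA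
  have hrankD := card_le_rank_incidenceMatrix_add_one (R := fun e i => S i e) hD
  rw [← transpose_incidenceMatrix, Matrix.rank_transpose, Matrix.rank] at hrankD
  have hrank := LinearMap.finrank_range_add_finrank_ker (incidenceMatrix D E S).mulVecLin
  rw [Module.finrank_pi, Fintype.card_coe] at hrank
  have hexact : LinearMap.range (incidenceMatrix E A R).mulVecLin =
      LinearMap.ker (incidenceMatrix D E S).mulVecLin := by
    refine Submodule.eq_of_le_of_finrank_le ?_ ?_
    · rw [LinearMap.range_le_ker_iff, ← Matrix.mulVecLin_mul, hmul, Matrix.mulVecLin_zero]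
    · rw [Matrix.rank] at hrankA
      omega
  have hmem : (fun e : E => if (e : β) ∈ C then (1 : ZMod 2) else 0) ∈
      LinearMap.range (incidenceMatrix E A R).mulVecLin := by
    rw [hexact, LinearMap.mem_ker, Matrix.mulVecLin_apply]
    funext i
    rw [incidenceMatrix_mulVec_indicator S hCE, Pi.zero_apply, ZMod.natCast_eq_zero_iff_even]
    exact hC i i.2
  obtain ⟨x, hx⟩ := hmem
  obtain ⟨T, hTA, rfl⟩ := exists_eq_indicator x
  refine ⟨T, hTA, fun e he => ?_⟩
  have hCe := congrFun hx ⟨e, he⟩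
  rw [Matrix.mulVecLin_apply, incidenceMatrix_mulVec_indicator R hTA] at hCe
  rw [← ZMod.natCast_eq_one_iff_odd, hCe]
  simp

end ModTwoComplex

/-- A simple `3`-polytope with facets indexed by `ι` is encoded by the family of its vertices, a
vertex being given by the set of the facets through it. -/
abbrev VertexFamily (ι : Type*) := Finset (Finset ι)

namespace VertexFamily

variable {ι : Type*} [DecidableEq ι] {K A : VertexFamily ι} {e s t u : Finset ι} {i : ι}

/-- The edges: pairs of facets with a common vertex. -/
def edges (K : VertexFamily ι) : Finset (Finset ι) := K.biUnion (powersetCard 2)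

/-- The edges with exactly one end in the set `A` of vertices. -/
def cut (K A : VertexFamily ι) : Finset (Finset ι) := {e ∈ edges K | #{t ∈ A | e ⊆ t} = 1}

/-- The edges with both ends in the set `A` of vertices. -/
def innerEdges (K A : VertexFamily ι) : Finset (Finset ι) := {e ∈ edges K | #{t ∈ A | e ⊆ t} = 2}

/-- The facets incident to an edge of the cut. -/
def rim (K A : VertexFamily ι) : Finset ι := (cut K A).biUnion id

/-- The facets with all vertices in `A`. -/
def innerFacets [Fintype ι] (K A : VertexFamily ι) : Finset ι := {i | ∀ t ∈ K, i ∈ t → t ∈ A}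

/-- The number of vertices of a facet, which is also the number of its edges. -/
def degree (K : VertexFamily ι) (i : ι) : ℕ := #{t ∈ K | i ∈ t}

/-- The number of incidences between the rim of `A` and the vertices in `A`. -/
def weight (K A : VertexFamily ι) : ℕ := ∑ i ∈ rim K A, #{t ∈ A | i ∈ t}

/-- The vertices in `A` lying on no facet of the rim of `A`. -/
def core (K A : VertexFamily ι) : VertexFamily ι := {t ∈ A | Disjoint t (rim K A)}

/-- The property of a linear functional `h` used in the simplex method: if `h` is not maximal at
the vertex `t` on a face containing it, then it is larger at some neighbour of `t` in this face. -/
def PivotsUp (K : VertexFamily ι) (h : Finset ι → ℝ) : Prop :=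
  ∀ t ∈ K, ∀ u ∈ K, h t < h u → ∃ s ∈ K, ∃ i ∈ t, i ∉ u ∧ t.erase i ⊆ s ∧ h t < h s

/-- The combinatorial properties of the vertices of a simple `3`-polytope. The height in
`exists_height` is a generic linear functional. -/
structure IsSimpleSphere (K : VertexFamily ι) : Prop where
  card_eq : ∀ t ∈ K, #t = 3
  cover : ∀ i, ∃ t ∈ K, i ∈ t
  card_star : ∀ t ∈ K, ∀ i ∈ t, #{s ∈ K | t.erase i ⊆ s} = 2
  exists_height : ∃ h : Finset ι → ℝ, Set.InjOn h K ∧ PivotsUp K h ∧ PivotsUp K (-h)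

theorem mem_edges : e ∈ edges K ↔ ∃ t ∈ K, e ⊆ t ∧ #e = 2 := by
  simp [edges, mem_powersetCard]

theorem card_of_mem_edges (he : e ∈ edges K) : #e = 2 := by
  obtain ⟨t, -, -, h⟩ := mem_edges.1 he
  exact h

theorem mem_edges_of_subset (ht : t ∈ K) (h : e ⊆ t) (he : #e = 2) : e ∈ edges K :=
  mem_edges.2 ⟨t, ht, h, he⟩

theorem cut_subset (K A : VertexFamily ι) : cut K A ⊆ edges K := filter_subset _ _

theorem mem_rim : i ∈ rim K A ↔ ∃ e ∈ cut K A, i ∈ e := by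
  simp [rim]

theorem subset_rim (he : e ∈ cut K A) : e ⊆ rim K A := fun _ hi => mem_rim.2 ⟨e, he, hi⟩

theorem edges_filter_subset (ht : t ∈ K) : {e ∈ edges K | e ⊆ t} = powersetCard 2 t := by
  ext e
  simp only [mem_filter, mem_powersetCard]
  exact ⟨fun h => ⟨h.2, card_of_mem_edges h.1⟩, fun h => ⟨mem_edges_of_subset ht h.1 h.2, h.1⟩⟩

namespace IsSimpleSphere

theorem nonempty [Nonempty ι] (hK : IsSimpleSphere K) : K.Nonempty := by
  obtain ⟨t, ht, -⟩ := hK.cover (Classical.arbitrary ι)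
  exact ⟨t, ht⟩

theorem nonempty_of_mem (hK : IsSimpleSphere K) (ht : t ∈ K) : t.Nonempty :=
  card_pos.1 (by rw [hK.card_eq t ht]; omega)

theorem erase_mem_edges (hK : IsSimpleSphere K) (ht : t ∈ K) (hi : i ∈ t) : t.erase i ∈ edges K :=
  mem_edges_of_subset ht (erase_subset _ _) (by rw [card_erase_of_mem hi, hK.card_eq t ht])

theorem exists_eq_erase (hK : IsSimpleSphere K) (he : e ∈ edges K) :
    ∃ t ∈ K, ∃ i ∈ t, e = t.erase i := by
  obtain ⟨t, ht, het, h2⟩ := mem_edges.1 he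
  obtain ⟨i, hie, rfl⟩ := (covBy_iff_card_sdiff_eq_one.2 ⟨het, by
    rw [card_sdiff_of_subset het, hK.card_eq t ht, h2]⟩).exists_finset_insert
  exact ⟨_, ht, i, mem_insert_self i e, (erase_insert hie).symm⟩

theorem card_ends (hK : IsSimpleSphere K) (he : e ∈ edges K) : #{t ∈ K | e ⊆ t} = 2 := by
  obtain ⟨t, ht, i, hi, rfl⟩ := hK.exists_eq_erase he
  exact hK.card_star t ht i hi

/-- A function on the vertices of the face `⋂ i ∈ X, i` that is constant along the edges of this
face is constant: from each vertex, pivot upwards inside the face to its highest vertex. -/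
theorem eq_of_adj (hK : IsSimpleSphere K) {α : Type*} {X : Finset ι} {f : Finset ι → α}
    (hf : ∀ e ∈ edges K, X ⊆ e → ∀ t ∈ K, ∀ u ∈ K, e ⊆ t → e ⊆ u → f t = f u)
    (ht : t ∈ K) (hu : u ∈ K) (hXt : X ⊆ t) (hXu : X ⊆ u) : f t = f u := by
  classical
  obtain ⟨h, hinj, hup, -⟩ := hK.exists_height
  obtain ⟨M, hM, hMmax⟩ := exists_max_image {s ∈ K | X ⊆ s} h ⟨t, by simp [ht, hXt]⟩
  simp only [mem_filter, and_imp] at hM hMmax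
  suffices hconst : ∀ s ∈ K, X ⊆ s → f s = f M by rw [hconst t ht hXt, hconst u hu hXu]
  by_contra! hcounter
  obtain ⟨s₀, hs₀, hXs₀, hfs₀⟩ := hcounter
  obtain ⟨s, hs, hsmax⟩ := exists_max_image {s ∈ K | X ⊆ s ∧ f s ≠ f M} h
    ⟨s₀, by simp [hs₀, hXs₀, hfs₀]⟩
  simp only [mem_filter, and_imp] at hs hsmax
  obtain ⟨hsK, hXs, hfs⟩ := hs
  have hlt : h s < h M := (hMmax s hsK hXs).lt_of_ne fun heq => hfs (by rw [hinj hsK hM.1 heq])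
  obtain ⟨r, hr, i, hi, hiM, hsub, hsr⟩ := hup s hsK M hM.1 hlt
  have hXe : X ⊆ s.erase i := fun x hx => mem_erase.2 ⟨fun h => hiM (h ▸ hM.2 hx), hXs hx⟩
  have hfsr := hf _ (hK.erase_mem_edges hsK hi) hXe s hsK r hr (erase_subset _ _) hsub
  exact (hsmax r hr (hXe.trans hsub) (hfsr ▸ hfs)).not_gt hsr

end IsSimpleSphere

section Euler

variable {h : Finset ι → ℝ}

/-- The facets through `t` on which `t` is a highest vertex. -/
noncomputable def topFacets (K : VertexFamily ι) (h : Finset ι → ℝ) (t : Finset ι) : Finset ι :=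
  {i ∈ t | ∀ u ∈ K, i ∈ u → h u ≤ h t}

/-- The facets through `t` that do not contain some edge going up from `t`. -/
noncomputable def upFacets (K : VertexFamily ι) (h : Finset ι → ℝ) (t : Finset ι) : Finset ι :=
  {i ∈ t | ∃ s ∈ K, t.erase i ⊆ s ∧ h t < h s}

theorem PivotsUp.topFacets_nonempty (hup : PivotsUp K h) (ht : t ∈ K) (hne : t.Nonempty)
    (hcard : #(upFacets K h t) ≤ 1) : (topFacets K h t).Nonempty := by
  obtain ⟨i, hi, hsub⟩ : ∃ i ∈ t, upFacets K h t ⊆ {i} := by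
    rcases (upFacets K h t).eq_empty_or_nonempty with hempty | ⟨i, hi⟩
    · obtain ⟨i, hi⟩ := hne
      exact ⟨i, hi, by simp [hempty]⟩
    · exact ⟨i, (mem_filter.1 hi).1, fun j hj => mem_singleton.2 (card_le_one.1 hcard j hj i hi)⟩
  refine ⟨i, mem_filter.2 ⟨hi, fun u hu hiu => ?_⟩⟩
  by_contra! hlt
  obtain ⟨s, hs, j, hjt, hju, hjs, hts⟩ := hup t ht u hu hlt
  have hji := mem_singleton.1 (hsub (mem_filter.2 ⟨hjt, s, hs, hjs, hts⟩))
  exact hju (hji ▸ hiu)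

theorem card_topFacets_of_forall_le (hmax : ∀ u ∈ K, h u ≤ h t) : #(topFacets K h t) = #t := by
  rw [topFacets, filter_true_of_mem fun i _ u hu _ => hmax u hu]

namespace IsSimpleSphere

theorem disjoint_upFacets_neg (hK : IsSimpleSphere K) (ht : t ∈ K) :
    Disjoint (upFacets K h t) (upFacets K (-h) t) := by
  refine disjoint_left.2 fun i hi hi' => ?_
  obtain ⟨hit, s, hs, his, hts⟩ := mem_filter.1 hi
  obtain ⟨-, r, hr, hir, htr⟩ := mem_filter.1 hi'
  simp only [Pi.neg_apply, neg_lt_neg_iff] at htr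
  have hthree : #{t, s, r} = 3 :=
    card_eq_three.2 ⟨t, s, r, fun h => by simp [h] at hts, fun h => by simp [h] at htr,
      fun h => by subst h; exact hts.not_gt htr, rfl⟩
  have hsub : {t, s, r} ⊆ {s ∈ K | t.erase i ⊆ s} := by
    simp [insert_subset_iff, ht, hs, hr, his, hir, erase_subset]
  have := card_le_card hsub
  rw [hK.card_star t ht i hit] at this
  omega

theorem one_le_card_topFacets_add (hK : IsSimpleSphere K) (hup : PivotsUp K h)
    (hdown : PivotsUp K (-h)) (ht : t ∈ K) :
    1 ≤ #(topFacets K h t) + #(topFacets K (-h) t) := by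
  have hcard : #(upFacets K h t) + #(upFacets K (-h) t) ≤ 3 := by
    rw [← card_union_of_disjoint (hK.disjoint_upFacets_neg ht), ← hK.card_eq t ht]
    exact card_le_card (union_subset (filter_subset _ _) (filter_subset _ _))
  have hne := hK.nonempty_of_mem ht
  rcases le_or_gt #(upFacets K h t) 1 with hle | hgt
  · have := card_pos.2 (hup.topFacets_nonempty ht hne hle)
    omega
  · have := card_pos.2 (hdown.topFacets_nonempty ht hne (by omega))
    omega

variable [Fintype ι]

theorem sum_card_topFacets (hK : IsSimpleSphere K) (hinj : Set.InjOn h K) :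
    ∑ t ∈ K, #(topFacets K h t) = Fintype.card ι := by
  classical
  have hdouble := sum_card_bipartiteAbove_eq_sum_card_bipartiteBelow (s := K) (t := univ)
    (fun t i => i ∈ topFacets K h t)
  simp only [bipartiteAbove, bipartiteBelow, filter_univ_mem] at hdouble
  rw [hdouble, ← card_univ, card_eq_sum_ones]
  refine sum_congr rfl fun i _ => ?_
  obtain ⟨t, ht, hit⟩ := hK.cover i
  obtain ⟨M, hM, hmax⟩ := exists_max_image {s ∈ K | i ∈ s} h ⟨t, by simp [ht, hit]⟩
  simp only [mem_filter, and_imp] at hM hmax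
  refine card_eq_one.2 ⟨M, ?_⟩
  ext s
  simp only [mem_filter, mem_singleton, topFacets]
  constructor
  · rintro ⟨hs, his, hsmax⟩
    exact hinj hs hM.1 (le_antisymm (hmax s hs his) (hsmax M hM.1 hM.2))
  · rintro rfl
    exact ⟨hM.1, hM.2, hmax⟩

/-- The inequality `f₀ + 4 ≤ 2 f₂`, half of Euler's formula. For a generic height, every vertex is
the highest or the lowest one of some facet through it, since its three edges cannot include two
going up and two going down. The two extreme vertices are so for all their three facets. -/
theorem card_add_four_le [Nonempty ι] (hK : IsSimpleSphere K) : #K + 4 ≤ 2 * Fintype.card ι := by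
  obtain ⟨h, hinj, hup, hdown⟩ := hK.exists_height
  obtain ⟨M, hM, hmax⟩ := exists_max_image K h hK.nonempty
  obtain ⟨m, hm, hmin⟩ := exists_min_image K h hK.nonempty
  have hMm : M ≠ m := by
    rintro rfl
    obtain ⟨i, hi⟩ := hK.nonempty_of_mem hM
    have hconst : ∀ t ∈ K, t = M := fun t ht =>
      hinj ht hM (le_antisymm (hmax t ht) (hmin t ht))
    have hle := card_le_one.2 fun s (hs : s ∈ ({s ∈ K | M.erase i ⊆ s} : Finset _)) t ht =>
      (hconst s (mem_filter.1 hs).1).trans (hconst t (mem_filter.1 ht).1).symm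
    rw [hK.card_star M hM i hi] at hle
    omega
  have htop := card_topFacets_of_forall_le hmax
  have hbot := card_topFacets_of_forall_le (h := -h) fun u hu => neg_le_neg (hmin u hu)
  have hcount : ∀ t ∈ K, 1 + ((if t = M then 2 else 0) + (if t = m then 2 else 0)) ≤
      #(topFacets K h t) + #(topFacets K (-h) t) := by
    intro t ht
    have hone := hK.one_le_card_topFacets_add hup hdown ht
    have hthree := hK.card_eq t ht
    split_ifs with htM htm htm
    · exact absurd (htM.symm.trans htm) hMm
    · subst htM
      omega
    · subst htm
      omega
    · omega
  have hinj' : Set.InjOn (-h) K := fun s hs t ht hst => hinj hs ht (neg_injective hst)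
  have hsum := sum_le_sum hcount
  simp only [sum_add_distrib, sum_ite_eq', hM, hm, if_true, sum_const, smul_eq_mul, mul_one,
    hK.sum_card_topFacets hinj, hK.sum_card_topFacets hinj'] at hsum
  omega

end IsSimpleSphere

end Euler

end VertexFamily

theorem card_filter_sdiff_add_card_filter {α : Type*} [DecidableEq α] {s t : Finset α}
    (h : t ⊆ s) (p : α → Prop) [DecidablePred p] :
    #{x ∈ s \ t | p x} + #{x ∈ t | p x} = #{x ∈ s | p x} := by
  rw [← card_union_of_disjoint (disjoint_filter_filter sdiff_disjoint), ← filter_union,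
    sdiff_union_of_subset h]

namespace VertexFamily

variable {ι : Type*} [DecidableEq ι] {K A B : VertexFamily ι} {e s t u : Finset ι} {i : ι}

theorem cut_singleton (ht : t ∈ K) : cut K {t} = powersetCard 2 t := by
  rw [← edges_filter_subset ht]
  ext e
  simp only [cut, mem_filter, filter_singleton]
  refine and_congr_right fun _ => ?_
  split_ifs with h <;> simp [h]

theorem mem_innerFacets [Fintype ι] : i ∈ innerFacets K A ↔ ∀ t ∈ K, i ∈ t → t ∈ A := by
  simp [innerFacets]

theorem innerFacets_mono [Fintype ι] (h : A ⊆ B) : innerFacets K A ⊆ innerFacets K B :=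
  fun _ hi => mem_innerFacets.2 fun t ht hit => h (mem_innerFacets.1 hi t ht hit)

theorem weight_eq_sum (K A : VertexFamily ι) : weight K A = ∑ t ∈ A, #(t ∩ rim K A) := by
  have hdouble := sum_card_bipartiteAbove_eq_sum_card_bipartiteBelow (s := rim K A) (t := A)
    (fun i t => i ∈ t)
  simp only [bipartiteAbove, bipartiteBelow] at hdouble
  rw [weight, hdouble]
  exact sum_congr rfl fun t _ => by rw [filter_mem_eq_inter, inter_comm]

theorem degree_eq_of_mem_innerFacets [Fintype ι] (hA : A ⊆ K) (hi : i ∈ innerFacets K A) :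
    degree K i = #{t ∈ A | i ∈ t} := by
  rw [degree]
  congr 1
  ext t
  simp only [mem_filter, and_congr_left_iff]
  exact fun hit => ⟨fun ht => mem_innerFacets.1 hi t ht hit, fun ht => hA ht⟩

theorem filter_edges_mem_subset (ht : t ∈ K) (i : ι) :
    {e ∈ edges K | i ∈ e ∧ e ⊆ t} = {e ∈ powersetCard 2 t | i ∈ e} := by
  rw [← edges_filter_subset ht, filter_filter]
  simp only [and_comm]

theorem sum_degree_le_of_forall {D : Finset ι} {n : ℕ} (h : ∀ i ∈ D, degree K i ≤ n) :
    ∑ i ∈ D, degree K i ≤ n * #D := by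
  rw [mul_comm, ← smul_eq_mul]
  exact sum_le_card_nsmul D _ n h

namespace IsSimpleSphere

/-! ### Cuts -/

theorem card_ends_sdiff_add (hK : IsSimpleSphere K) (hA : A ⊆ K) (he : e ∈ edges K) :
    #{t ∈ K \ A | e ⊆ t} + #{t ∈ A | e ⊆ t} = 2 := by
  rw [card_filter_sdiff_add_card_filter hA, hK.card_ends he]

theorem mem_cut_iff (hK : IsSimpleSphere K) (hA : A ⊆ K) :
    e ∈ cut K A ↔ #e = 2 ∧ ∃ t ∈ A, ∃ u ∈ K \ A, e ⊆ t ∧ e ⊆ u := by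
  constructor
  · intro h
    obtain ⟨he, hone⟩ := mem_filter.1 h
    have htwo := hK.card_ends_sdiff_add hA he
    obtain ⟨t, ht⟩ := card_pos.1 (by omega : 0 < #{t ∈ A | e ⊆ t})
    obtain ⟨u, hu⟩ := card_pos.1 (by omega : 0 < #{t ∈ K \ A | e ⊆ t})
    rw [mem_filter] at ht hu
    exact ⟨card_of_mem_edges he, t, ht.1, u, hu.1, ht.2, hu.2⟩
  · rintro ⟨h2, t, ht, u, hu, het, heu⟩
    have he := mem_edges_of_subset (hA ht) het h2
    have htwo := hK.card_ends_sdiff_add hA he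
    have ht' : 0 < #{t ∈ A | e ⊆ t} := card_pos.2 ⟨t, mem_filter.2 ⟨ht, het⟩⟩
    have hu' : 0 < #{t ∈ K \ A | e ⊆ t} := card_pos.2 ⟨u, mem_filter.2 ⟨hu, heu⟩⟩
    exact mem_filter.2 ⟨he, by omega⟩

theorem cut_sdiff (hK : IsSimpleSphere K) (hA : A ⊆ K) : cut K (K \ A) = cut K A := by
  refine filter_congr fun e he => ?_
  have := hK.card_ends_sdiff_add hA he
  omega

theorem rim_sdiff (hK : IsSimpleSphere K) (hA : A ⊆ K) : rim K (K \ A) = rim K A := by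
  rw [rim, rim, hK.cut_sdiff hA]

theorem mem_iff_mem_of_forall_cut (hK : IsSimpleSphere K) (hA : A ⊆ K) {X : Finset ι}
    (hX : ∀ e ∈ cut K A, ¬ X ⊆ e) (ht : t ∈ K) (hu : u ∈ K) (hXt : X ⊆ t) (hXu : X ⊆ u) :
    t ∈ A ↔ u ∈ A := by
  have hadj : ∀ e ∈ edges K, X ⊆ e → ∀ t ∈ K, ∀ u ∈ K, e ⊆ t → e ⊆ u → t ∈ A → u ∈ A := by
    intro e he hXe t _ u hu het heu htA
    by_contra huA
    exact hX e ((hK.mem_cut_iff hA).2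
      ⟨card_of_mem_edges he, t, htA, u, mem_sdiff.2 ⟨hu, huA⟩, het, heu⟩) hXe
  exact iff_of_eq (hK.eq_of_adj (f := (· ∈ A)) (fun e he hXe t ht u hu het heu =>
    propext ⟨hadj e he hXe t ht u hu het heu, hadj e he hXe u hu t ht heu het⟩) ht hu hXt hXu)

theorem mem_iff_mem_of_notMem_rim (hK : IsSimpleSphere K) (hA : A ⊆ K) (hi : i ∉ rim K A)
    (ht : t ∈ K) (hu : u ∈ K) (hit : i ∈ t) (hiu : i ∈ u) : t ∈ A ↔ u ∈ A :=
  hK.mem_iff_mem_of_forall_cut hA (X := {i})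
    (fun e he hie => hi (mem_rim.2 ⟨e, he, singleton_subset_iff.1 hie⟩)) ht hu
    (singleton_subset_iff.2 hit) (singleton_subset_iff.2 hiu)

theorem eq_empty_or_eq_of_cut_eq_empty (hK : IsSimpleSphere K) (hA : A ⊆ K)
    (hcut : cut K A = ∅) : A = ∅ ∨ A = K := by
  refine A.eq_empty_or_nonempty.imp_right fun ⟨t, ht⟩ => hA.antisymm fun u hu => ?_
  exact (hK.mem_iff_mem_of_forall_cut hA (by simp [hcut]) (hA ht) hu (empty_subset _)
    (empty_subset _)).1 ht

theorem mem_cut_iff_of_ne (hK : IsSimpleSphere K) (hA : A ⊆ K) (he : e ∈ edges K) (ht : t ∈ K)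
    (hu : u ∈ K) (het : e ⊆ t) (heu : e ⊆ u) (htu : t ≠ u) :
    e ∈ cut K A ↔ ¬ (t ∈ A ↔ u ∈ A) := by
  have hends : {s ∈ K | e ⊆ s} = {t, u} := by
    refine (eq_of_subset_of_card_le (by simp [insert_subset_iff, *]) ?_).symm
    rw [hK.card_ends he, card_pair htu]
  have hA' : {s ∈ A | e ⊆ s} = {s ∈ ({t, u} : Finset _) | s ∈ A} := by
    rw [← hends, filter_filter, filter_and, inter_comm]
    ext s
    simp only [mem_filter, mem_inter]
    exact ⟨fun h => ⟨⟨hA h.1, h.1⟩, hA h.1, h.2⟩, fun h => ⟨h.1.2, h.2.2⟩⟩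
  rw [cut, mem_filter, and_iff_right he, hA', filter_insert, filter_singleton]
  split_ifs with htA huA huA <;> simp [*]

theorem eq_or_eq_sdiff_of_cut_eq (hK : IsSimpleSphere K) (hA : A ⊆ K) (hB : B ⊆ K)
    (h : cut K A = cut K B) : A = B ∨ A = K \ B := by
  have hadj : ∀ e ∈ edges K, ∅ ⊆ e → ∀ t ∈ K, ∀ u ∈ K, e ⊆ t → e ⊆ u →
      (t ∈ A ↔ t ∈ B) = (u ∈ A ↔ u ∈ B) := by
    intro e he _ t ht u hu het heu
    rcases eq_or_ne t u with rfl | htu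
    · rfl
    · have hmemA := hK.mem_cut_iff_of_ne hA he ht hu het heu htu
      have hmemB := hK.mem_cut_iff_of_ne hB he ht hu het heu htu
      rw [h] at hmemA
      exact propext (by tauto)
  by_cases hall : ∀ t ∈ K, (t ∈ A ↔ t ∈ B)
  · exact Or.inl (ext fun t => ⟨fun h => (hall t (hA h)).1 h, fun h => (hall t (hB h)).2 h⟩)
  · push Not at hall
    obtain ⟨t, ht, hne⟩ := hall
    refine Or.inr (ext fun u => ?_)
    have hu : u ∈ K → ¬ (u ∈ A ↔ u ∈ B) := fun hu => by
      rw [← hK.eq_of_adj (f := fun t => (t ∈ A ↔ t ∈ B)) hadj ht hu (empty_subset _)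
        (empty_subset _)]
      tauto
    have := @hA u
    rw [mem_sdiff]
    tauto

theorem sum_edges_card (hK : IsSimpleSphere K) (hA : A ⊆ K) :
    ∑ e ∈ edges K, #{t ∈ A | e ⊆ t} = 3 * #A := by
  have hdouble := sum_card_bipartiteAbove_eq_sum_card_bipartiteBelow (s := edges K) (t := A)
    (fun e t => e ⊆ t)
  simp only [bipartiteAbove, bipartiteBelow] at hdouble
  rw [hdouble, mul_comm, ← smul_eq_mul]
  refine sum_const_nat fun t ht => ?_
  rw [edges_filter_subset (hA ht), card_powersetCard, hK.card_eq t (hA ht)]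
  rfl

theorem two_mul_card_innerEdges (hK : IsSimpleSphere K) (hA : A ⊆ K) :
    2 * #(innerEdges K A) + #(cut K A) = 3 * #A := by
  rw [← hK.sum_edges_card hA, innerEdges, cut, card_filter, card_filter, mul_sum,
    ← sum_add_distrib]
  refine sum_congr rfl fun e he => ?_
  have := hK.card_ends_sdiff_add hA he
  split_ifs <;> omega

theorem even_card_edges_mem_subset (hK : IsSimpleSphere K) (ht : t ∈ K) (i : ι) :
    Even #{e ∈ edges K | i ∈ e ∧ e ⊆ t} := by
  rw [filter_edges_mem_subset ht]
  exact (isEvenGraph_powersetCard_two (hK.card_eq t ht)).even i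

theorem sum_edges_mem_card (hK : IsSimpleSphere K) (hA : A ⊆ K) (i : ι) :
    ∑ e ∈ edges K with i ∈ e, #{t ∈ A | e ⊆ t} = 2 * #{t ∈ A | i ∈ t} := by
  have hdouble := sum_card_bipartiteAbove_eq_sum_card_bipartiteBelow
    (s := {e ∈ edges K | i ∈ e}) (t := A) (fun e t => e ⊆ t)
  simp only [bipartiteAbove, bipartiteBelow, filter_filter] at hdouble
  rw [hdouble, card_filter, mul_sum]
  refine sum_congr rfl fun t ht => ?_
  rw [filter_edges_mem_subset (hA ht)]
  split_ifs with hi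
  · exact card_powersetCard_two_filter_mem (hK.card_eq t (hA ht)) hi
  · exact card_eq_zero.2 (filter_false_of_mem fun e he hie => hi ((mem_powersetCard.1 he).1 hie))

theorem card_edges_mem_eq_degree (hK : IsSimpleSphere K) (i : ι) :
    #{e ∈ edges K | i ∈ e} = degree K i := by
  have hsum := hK.sum_edges_mem_card Subset.rfl i
  rw [sum_const_nat fun e he => hK.card_ends (mem_filter.1 he).1] at hsum
  rw [degree]
  omega

theorem isEvenGraph_cut (hK : IsSimpleSphere K) (hA : A ⊆ K) : IsEvenGraph (cut K A) := by
  refine ⟨fun e he => card_of_mem_edges (cut_subset _ _ he), fun i => ?_⟩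
  have hodd : {e ∈ cut K A | i ∈ e} = {e ∈ {e ∈ edges K | i ∈ e} | Odd #{t ∈ A | e ⊆ t}} := by
    rw [cut, filter_comm]
    refine filter_congr fun e he => ?_
    have := hK.card_ends_sdiff_add hA (mem_filter.1 he).1
    rw [Nat.odd_iff]
    omega
  rw [hodd, ← even_sum_iff_even_card_odd, hK.sum_edges_mem_card hA]
  exact even_two_mul _

theorem three_le_card_cut (hK : IsSimpleSphere K) (hA : A ⊆ K) (h0 : A.Nonempty) (h1 : A ≠ K) :
    3 ≤ #(cut K A) := by
  refine (hK.isEvenGraph_cut hA).three_le_card (nonempty_iff_ne_empty.2 fun hcut => ?_)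
  rcases hK.eq_empty_or_eq_of_cut_eq_empty hA hcut with h | h
  exacts [h0.ne_empty h, h1 h]

theorem card_rim_le (hK : IsSimpleSphere K) (hA : A ⊆ K) : #(rim K A) ≤ #(cut K A) := by
  have hdouble := sum_card_bipartiteAbove_eq_sum_card_bipartiteBelow (s := rim K A) (t := cut K A)
    (fun i e => i ∈ e)
  simp only [bipartiteAbove, bipartiteBelow] at hdouble
  have htwo : ∀ e ∈ cut K A, #{i ∈ rim K A | i ∈ e} = 2 := fun e he => by
    rw [filter_mem_eq_inter, inter_eq_right.2 (subset_rim he),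
      card_of_mem_edges (cut_subset _ _ he)]
  have hle : #(rim K A) • 2 ≤ ∑ i ∈ rim K A, #{e ∈ cut K A | i ∈ e} := by
    refine card_nsmul_le_sum _ _ _ fun i hi => ?_
    obtain ⟨e, he, hie⟩ := mem_rim.1 hi
    have hpos : 0 < #{e ∈ cut K A | i ∈ e} := card_pos.2 ⟨e, by simp [he, hie]⟩
    obtain ⟨r, hr⟩ := (hK.isEvenGraph_cut hA).even i
    omega
  rw [hdouble, sum_const_nat htwo, smul_eq_mul] at hle
  omega

/-- One side of a cut with at most five edges is connected, since every cut has at least three. -/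
theorem eq_empty_or_eq_of_forall_even_innerEdges (hK : IsSimpleSphere K) (hA : A ⊆ K)
    (hAK : A ≠ K) (h5 : #(cut K A) ≤ 5) (hBA : B ⊆ A)
    (heven : ∀ e ∈ innerEdges K A, Even #{t ∈ B | e ⊆ t}) : B = ∅ ∨ B = A := by
  have hne : ∀ B ⊆ A, B ≠ K := fun B hB h => hAK (hA.antisymm (h ▸ hB))
  by_contra! hcon
  have hB := hK.three_le_card_cut (hBA.trans hA) hcon.1 (hne B hBA)
  have hAB := hK.three_le_card_cut (sdiff_subset.trans hA)
    (sdiff_nonempty.2 fun h => hcon.2 (hBA.antisymm h)) (hne (A \ B) sdiff_subset)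
  have hadd : #(cut K B) + #(cut K (A \ B)) ≤ #(cut K A) := by
    rw [cut, cut, cut, card_filter, card_filter, card_filter, ← sum_add_distrib]
    refine sum_le_sum fun e he => ?_
    have hsum := card_filter_sdiff_add_card_filter hBA (e ⊆ ·)
    have htwo := hK.card_ends_sdiff_add hA he
    have hinner : #{t ∈ A | e ⊆ t} = 2 → Even #{t ∈ B | e ⊆ t} := fun h =>
      heven e (mem_filter.2 ⟨he, h⟩)
    rw [Nat.even_iff] at hinner
    split_ifs <;> omega
  omega

theorem weight_add_weight_sdiff (hK : IsSimpleSphere K) (hA : A ⊆ K) :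
    weight K A + weight K (K \ A) = ∑ i ∈ rim K A, degree K i := by
  rw [weight, weight, hK.rim_sdiff hA, ← sum_add_distrib]
  refine sum_congr rfl fun i _ => ?_
  rw [add_comm, card_filter_sdiff_add_card_filter hA, degree]

/-! ### Euler's formula for one side of a short cut -/

theorem eq_empty_or_eq_univ_of_forall_even [Fintype ι] (hK : IsSimpleSphere K) {J : Finset ι}
    (hJ : ∀ e ∈ edges K, Even #{i ∈ J | i ∈ e}) : J = ∅ ∨ J = univ := by
  have hvertex : ∀ t ∈ K, ∀ i ∈ t, i ∈ J → t ⊆ J := by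
    intro t ht i hit hiJ j hjt
    by_contra hjJ
    have hij : i ≠ j := fun h => hjJ (h ▸ hiJ)
    have heven := hJ {i, j} (mem_edges_of_subset ht (by simp [insert_subset_iff, hit, hjt])
      (card_pair hij))
    rw [filter_mem_eq_inter, inter_insert_of_mem hiJ, inter_singleton_of_notMem hjJ] at heven
    simp at heven
  refine J.eq_empty_or_nonempty.imp_right fun ⟨i, hi⟩ => eq_univ_iff_forall.2 fun j => ?_
  obtain ⟨t, ht, hit⟩ := hK.cover i
  obtain ⟨u, hu, hju⟩ := hK.cover j
  have hadj : ∀ e ∈ edges K, ∀ t ∈ K, ∀ u ∈ K, e ⊆ t → e ⊆ u → t ⊆ J → u ⊆ J := by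
    intro e he t _ u hu het heu htJ
    obtain ⟨k, hk⟩ := card_pos.1 (by rw [card_of_mem_edges he]; omega : 0 < #e)
    exact hvertex u hu k (heu hk) (htJ (het hk))
  have htu : t ⊆ J ↔ u ⊆ J := iff_of_eq (hK.eq_of_adj (X := ∅) (f := (· ⊆ J))
    (fun e he _ t ht u hu het heu => propext
      ⟨hadj e he t ht u hu het heu, hadj e he u hu t ht heu het⟩) ht hu
    (empty_subset _) (empty_subset _))
  exact htu.1 (hvertex t ht i hit hi) hju

theorem exists_cut_eq [Finite ι] [Nonempty ι] (hK : IsSimpleSphere K) {C : Finset (Finset ι)}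
    (hCK : C ⊆ edges K) (hC : IsEvenGraph C) : ∃ A ⊆ K, cut K A = C := by
  have := Fintype.ofFinite ι
  have hconn : ∀ T ⊆ K, (∀ e ∈ edges K, Even #{t ∈ T | e ⊆ t}) → T = ∅ ∨ T = K := by
    intro T hT heven
    refine hK.eq_empty_or_eq_of_cut_eq_empty hT (filter_eq_empty_iff.2 fun e he hone => ?_)
    have := heven e he
    rw [hone] at this
    exact Nat.not_even_one this
  have hcard : #(edges K) + 2 ≤ #K + #(univ : Finset ι) := by
    have hsum := hK.sum_edges_card Subset.rfl
    rw [sum_const_nat fun e he => hK.card_ends he] at hsum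
    have := hK.card_add_four_le
    rw [card_univ]
    omega
  obtain ⟨T, hT, hmem⟩ := exists_odd_iff_mem_of_forall_even (R := fun e t => e ⊆ t)
    (S := fun i e => i ∈ e) (fun t ht i _ => hK.even_card_edges_mem_subset ht i) hconn
    (fun J _ hJ => hK.eq_empty_or_eq_univ_of_forall_even hJ) hcard hCK (fun i _ => hC.even i)
  refine ⟨T, hT, ?_⟩
  rw [← inter_eq_right.2 hCK, ← filter_mem_eq_inter, cut]
  refine filter_congr fun e he => ?_
  have := hK.card_ends_sdiff_add hT he
  rw [hmem e he, Nat.odd_iff]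
  omega

variable [Fintype ι]

theorem mem_innerEdges_of_mem_innerFacets (hK : IsSimpleSphere K) (hA : A ⊆ K)
    (hi : i ∈ innerFacets K A) (he : e ∈ edges K) (hie : i ∈ e) : e ∈ innerEdges K A := by
  refine mem_filter.2 ⟨he, ?_⟩
  rw [← hK.card_ends he]
  congr 1
  ext t
  simp only [mem_filter, and_congr_left_iff]
  exact fun het => ⟨fun ht => hA ht, fun ht => mem_innerFacets.1 hi t ht (het hie)⟩

theorem card_add_card_innerFacets_le (hK : IsSimpleSphere K) (hA : A ⊆ K) (hAK : A ≠ K)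
    (h5 : #(cut K A) ≤ 5) : #A + #(innerFacets K A) ≤ #(innerEdges K A) + 1 := by
  refine card_add_card_le_card_add_one (R := fun e t => e ⊆ t) (S := fun i e => i ∈ e) ?_
    (fun B hBA => hK.eq_empty_or_eq_of_forall_even_innerEdges hA hAK h5 hBA) ?_
  · intro t ht i hi
    convert hK.even_card_edges_mem_subset (hA ht) i using 2
    ext e
    simp only [mem_filter, and_congr_left_iff]
    exact fun h => ⟨fun he => (mem_filter.1 he).1, fun he =>
      hK.mem_innerEdges_of_mem_innerFacets hA hi he h.1⟩
  · intro J hJ heven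
    have heven' : ∀ e ∈ edges K, Even #{i ∈ J | i ∈ e} := by
      intro e he
      by_cases hinner : e ∈ innerEdges K A
      · exact heven e hinner
      · rw [filter_false_of_mem fun i hi hie => hinner
          (hK.mem_innerEdges_of_mem_innerFacets hA (hJ hi) he hie)]
        exact Even.zero
    refine (hK.eq_empty_or_eq_univ_of_forall_even heven').resolve_right fun huniv => hAK ?_
    refine hA.antisymm fun t ht => ?_
    obtain ⟨i, hi⟩ := hK.nonempty_of_mem ht
    exact mem_innerFacets.1 (hJ (huniv ▸ mem_univ i)) t ht hi

theorem notMem_rim_of_mem_innerFacets (hK : IsSimpleSphere K) (hA : A ⊆ K)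
    (hi : i ∈ innerFacets K A) : i ∉ rim K A := by
  intro h
  obtain ⟨e, he, hie⟩ := mem_rim.1 h
  obtain ⟨-, -, -, u, hu, -, heu⟩ := (hK.mem_cut_iff hA).1 he
  rw [mem_sdiff] at hu
  exact hu.2 (mem_innerFacets.1 hi u hu.1 (heu hie))

theorem notMem_innerFacets_sdiff (hK : IsSimpleSphere K) (hi : i ∈ innerFacets K A) :
    i ∉ innerFacets K (K \ A) := by
  intro h
  obtain ⟨t, ht, hit⟩ := hK.cover i
  exact (mem_sdiff.1 (mem_innerFacets.1 h t ht hit)).2 (mem_innerFacets.1 hi t ht hit)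

theorem mem_innerFacets_of_mem (hK : IsSimpleSphere K) (hA : A ⊆ K) (hi : i ∉ rim K A)
    (ht : t ∈ A) (hit : i ∈ t) : i ∈ innerFacets K A :=
  mem_innerFacets.2 fun _ hu hiu => (hK.mem_iff_mem_of_notMem_rim hA hi (hA ht) hu hit hiu).1 ht

theorem mem_innerFacets_or_of_notMem_rim (hK : IsSimpleSphere K) (hA : A ⊆ K)
    (hi : i ∉ rim K A) : i ∈ innerFacets K A ∨ i ∈ innerFacets K (K \ A) := by
  obtain ⟨t, ht, hit⟩ := hK.cover i
  by_cases htA : t ∈ A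
  · exact Or.inl (hK.mem_innerFacets_of_mem hA hi htA hit)
  · exact Or.inr (hK.mem_innerFacets_of_mem sdiff_subset (by rwa [hK.rim_sdiff hA])
      (mem_sdiff.2 ⟨ht, htA⟩) hit)

theorem card_le_card_innerFacets_add (hK : IsSimpleSphere K) (hA : A ⊆ K) :
    Fintype.card ι ≤ #(innerFacets K A) + #(innerFacets K (K \ A)) + #(rim K A) := by
  have hcover : univ ⊆ innerFacets K A ∪ innerFacets K (K \ A) ∪ rim K A := by
    intro i _
    rw [mem_union, mem_union]
    by_cases hi : i ∈ rim K A
    · exact Or.inr hi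
    · exact Or.inl (hK.mem_innerFacets_or_of_notMem_rim hA hi)
  rw [← card_univ]
  exact (card_le_card hcover).trans ((card_union_le _ _).trans
    (Nat.add_le_add_right (card_union_le _ _) _))

/-- Euler's formula gives `≤` for both sides, and the sum of these two inequalities is an
equality by Euler's formula for the whole sphere. -/
theorem two_mul_card_innerFacets [Nonempty ι] (hK : IsSimpleSphere K) (hA : A ⊆ K)
    (h0 : A.Nonempty) (hAK : A ≠ K) (h5 : #(cut K A) ≤ 5) :
    2 * #(innerFacets K A) + #(cut K A) = #A + 2 := by
  have hleA := hK.card_add_card_innerFacets_le hA hAK h5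
  have hedgesA := hK.two_mul_card_innerEdges hA
  have hleB := hK.card_add_card_innerFacets_le (A := K \ A) sdiff_subset (sdiff_ssubset hA h0).ne
    (by rwa [hK.cut_sdiff hA])
  have hedgesB := hK.two_mul_card_innerEdges (A := K \ A) sdiff_subset
  rw [hK.cut_sdiff hA] at hedgesB
  have hcard := card_sdiff_add_card_eq_card hA
  have hfacets := hK.card_le_card_innerFacets_add hA
  have hrim := hK.card_rim_le hA
  have heuler := hK.card_add_four_le
  omega

theorem sum_degree_add_weight (hK : IsSimpleSphere K) (hA : A ⊆ K) :
    ∑ i ∈ innerFacets K A, degree K i + weight K A = 3 * #A := by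
  have hdisj : Disjoint (innerFacets K A) (rim K A) :=
    disjoint_left.2 fun i hi => hK.notMem_rim_of_mem_innerFacets hA hi
  have hdouble := sum_card_bipartiteAbove_eq_sum_card_bipartiteBelow
    (s := innerFacets K A ∪ rim K A) (t := A) (fun i t => i ∈ t)
  simp only [bipartiteAbove, bipartiteBelow] at hdouble
  rw [sum_congr rfl fun i hi => degree_eq_of_mem_innerFacets hA hi, weight,
    ← sum_union hdisj, hdouble, mul_comm]
  refine sum_const_nat fun t ht => ?_
  rw [filter_mem_eq_inter, inter_eq_right.2, hK.card_eq t (hA ht)]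
  intro i hi
  by_cases hr : i ∈ rim K A
  · exact mem_union_right _ hr
  · exact mem_union_left _ (hK.mem_innerFacets_of_mem hA hr ht hi)

theorem weight_mono [Nonempty ι] (hK : IsSimpleSphere K) (hA : A ⊆ K) (hBA : B ⊆ A)
    (h0 : B.Nonempty) (hAK : A ≠ K) (h5 : #(cut K A) ≤ 5) (hcut : #(cut K B) = #(cut K A))
    (hdeg : ∀ i ∈ innerFacets K A, degree K i ≤ 6) : weight K B ≤ weight K A := by
  have hBK : B ≠ K := fun h => hAK (hA.antisymm (h ▸ hBA))
  have hfacetsA := hK.two_mul_card_innerFacets hA (h0.mono hBA) hAK h5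
  have hfacetsB := hK.two_mul_card_innerFacets (hBA.trans hA) h0 hBK (by omega)
  have hsumA := hK.sum_degree_add_weight hA
  have hsumB := hK.sum_degree_add_weight (hBA.trans hA)
  have hsub := innerFacets_mono (K := K) hBA
  have hsum := sum_sdiff hsub (f := degree K)
  have hle := sum_degree_le_of_forall (K := K) fun i
    (hi : i ∈ innerFacets K A \ innerFacets K B) => hdeg i (mem_sdiff.1 hi).1
  have := card_sdiff_add_card_eq_card hsub
  omega

end IsSimpleSphere

end VertexFamily

namespace VertexFamily

variable {ι : Type*} [DecidableEq ι] {K A : VertexFamily ι} {S e t : Finset ι} {a b c d i q x : ι}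

/-! ### Sides of a belt -/

/-- The set `A` of vertices is one of the two sides of a chordless cyclic sequence of facets, the
sequence being encoded by the cut of `A`. -/
structure BeltSide (K A : VertexFamily ι) : Prop where
  subset : A ⊆ K
  not_subset_rim : ∀ t ∈ K, ¬ t ⊆ rim K A
  mem_cut_of_subset_rim : ∀ e ∈ edges K, e ⊆ rim K A → e ∈ cut K A

theorem core_subset (K A : VertexFamily ι) : core K A ⊆ A := filter_subset _ _

namespace BeltSide

theorem sdiff (h : BeltSide K A) (hK : IsSimpleSphere K) : BeltSide K (K \ A) where
  subset := sdiff_subset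
  not_subset_rim := by
    rw [hK.rim_sdiff h.subset]
    exact h.not_subset_rim
  mem_cut_of_subset_rim := by
    rw [hK.rim_sdiff h.subset, hK.cut_sdiff h.subset]
    exact h.mem_cut_of_subset_rim

theorem nonempty (h : BeltSide K A) (hK : IsSimpleSphere K) (hcut : 0 < #(cut K A)) :
    A.Nonempty := by
  obtain ⟨e, he⟩ := card_pos.1 hcut
  obtain ⟨-, t, ht, -⟩ := (hK.mem_cut_iff h.subset).1 he
  exact ⟨t, ht⟩

theorem ne (h : BeltSide K A) (hK : IsSimpleSphere K) (hcut : 0 < #(cut K A)) : A ≠ K := by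
  obtain ⟨u, hu⟩ := (h.sdiff hK).nonempty hK (by rwa [hK.cut_sdiff h.subset])
  rw [mem_sdiff] at hu
  exact fun h => hu.2 (h ▸ hu.1)

theorem core_ne (h : BeltSide K A) (hK : IsSimpleSphere K) (hcut : 0 < #(cut K A)) :
    core K A ≠ K :=
  fun hcore => h.ne hK hcut (h.subset.antisymm (hcore.ge.trans (core_subset K A)))

theorem card_inter_rim_le (h : BeltSide K A) (hK : IsSimpleSphere K) (ht : t ∈ K) :
    #(t ∩ rim K A) ≤ 2 := by
  by_contra! hlt
  have hinter : t ∩ rim K A = t :=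
    eq_of_subset_of_card_le inter_subset_left (by rw [hK.card_eq t ht]; omega)
  exact h.not_subset_rim t ht (inter_eq_left.1 hinter)

theorem card_filter_card_inter_rim_eq_two (h : BeltSide K A) (hK : IsSimpleSphere K) :
    #{t ∈ A | #(t ∩ rim K A) = 2} = #(cut K A) := by
  have hmaps : ∀ t ∈ {t ∈ A | #(t ∩ rim K A) = 2}, t ∩ rim K A ∈ cut K A := by
    intro t ht
    rw [mem_filter] at ht
    exact h.mem_cut_of_subset_rim _
      (mem_edges_of_subset (h.subset ht.1) inter_subset_left ht.2) inter_subset_right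
  refine card_nbij (· ∩ rim K A) hmaps ?_ ?_
  · intro t ht u hu (htu : t ∩ rim K A = u ∩ rim K A)
    have hends := (mem_filter.1 (hmaps t ht)).2
    exact card_le_one.1 hends.le t
      (mem_filter.2 ⟨(mem_filter.1 ht).1, inter_subset_left⟩) u
      (mem_filter.2 ⟨(mem_filter.1 hu).1, htu ▸ inter_subset_left⟩)
  · intro e he
    obtain ⟨h2, t, ht, -, -, het, -⟩ := (hK.mem_cut_iff h.subset).1 he
    have hcard := h.card_inter_rim_le hK (h.subset ht)
    have heq : e = t ∩ rim K A :=
      eq_of_subset_of_card_le (subset_inter het (subset_rim he)) (by omega)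
    exact ⟨t, mem_filter.2 ⟨ht, heq ▸ h2⟩, heq.symm⟩

/-- Outwards from the core, every edge leads to a vertex on exactly one facet of the rim, and this
vertex has no other edge to the core. -/
theorem card_cut_core_le (h : BeltSide K A) (hK : IsSimpleSphere K) :
    #(cut K (core K A)) ≤ #{t ∈ A | #(t ∩ rim K A) = 1} := by
  refine (card_le_card fun e he => ?_).trans (card_image_le (s := {t ∈ A | #(t ∩ rim K A) = 1})
    (f := (· \ rim K A)))
  obtain ⟨h2, t, ht, u, hu, het, heu⟩ :=
    (hK.mem_cut_iff ((core_subset K A).trans h.subset)).1 he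
  obtain ⟨htA, htr⟩ := mem_filter.1 ht
  obtain ⟨huK, hucore⟩ := mem_sdiff.1 hu
  have hdisj : Disjoint e (rim K A) := disjoint_of_subset_left het htr
  have huA : u ∈ A := by
    by_contra huA
    have hcut := (hK.mem_cut_iff h.subset).2 ⟨h2, t, htA, u, mem_sdiff.2 ⟨huK, huA⟩, het, heu⟩
    rw [disjoint_of_le_iff_left_eq_bot (subset_rim hcut)] at hdisj
    simp [hdisj] at h2
  have hinter : 0 < #(u ∩ rim K A) := by
    rw [card_pos, ← not_disjoint_iff_nonempty_inter]
    exact fun hur => hucore (mem_filter.2 ⟨huA, hur⟩)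
  have hsub : e ⊆ u \ rim K A := subset_sdiff.2 ⟨heu, hdisj⟩
  have hle := card_le_card hsub
  have hadd := card_sdiff_add_card_inter u (rim K A)
  rw [hK.card_eq u huK] at hadd
  exact mem_image.2 ⟨u, mem_filter.2 ⟨huA, by omega⟩,
    (eq_of_subset_of_card_le hsub (by omega)).symm⟩

theorem weight_eq (h : BeltSide K A) (hK : IsSimpleSphere K) :
    weight K A = #{t ∈ A | #(t ∩ rim K A) = 1} + 2 * #(cut K A) := by
  rw [← h.card_filter_card_inter_rim_eq_two hK, weight_eq_sum, card_filter, card_filter, mul_sum,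
    ← sum_add_distrib]
  refine sum_congr rfl fun t ht => ?_
  have := h.card_inter_rim_le hK (h.subset ht)
  split_ifs <;> omega

theorem card_eq (h : BeltSide K A) (hK : IsSimpleSphere K) :
    #A = #(core K A) + #{t ∈ A | #(t ∩ rim K A) = 1} + #(cut K A) := by
  rw [← h.card_filter_card_inter_rim_eq_two hK, core, card_filter, card_filter, card_filter,
    ← sum_add_distrib, ← sum_add_distrib, card_eq_sum_ones]
  refine sum_congr rfl fun t ht => ?_
  have := h.card_inter_rim_le hK (h.subset ht)
  simp only [disjoint_iff_inter_eq_empty, ← card_eq_zero]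
  split_ifs <;> omega

theorem card_add_card_cut (h : BeltSide K A) (hK : IsSimpleSphere K) :
    #A + #(cut K A) = #(core K A) + weight K A := by
  have := h.weight_eq hK
  have := h.card_eq hK
  omega

theorem card_core_add_le (h : BeltSide K A) (hK : IsSimpleSphere K) :
    #(core K A) + #(cut K A) ≤ #A := by
  have := h.card_eq hK
  omega

theorem card_cut_core_add_le (h : BeltSide K A) (hK : IsSimpleSphere K) :
    #(cut K (core K A)) + 2 * #(cut K A) ≤ weight K A := by
  have := h.weight_eq hK
  have := h.card_cut_core_le hK
  omega

end BeltSide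

/-! ### Cuts with three and four edges -/

theorem rim_eq_of_cut_eq_powersetCard_two (hcut : cut K A = powersetCard 2 S) (hS : #S = 3) :
    rim K A = S := by
  ext i
  rw [mem_rim, hcut]
  refine ⟨fun ⟨e, he, hie⟩ => (mem_powersetCard.1 he).1 hie, fun hi => ?_⟩
  obtain ⟨e, he⟩ : ∃ e, e ∈ {e ∈ powersetCard 2 S | i ∈ e} :=
    card_pos.1 (by rw [card_powersetCard_two_filter_mem hS hi]; omega)
  exact ⟨e, mem_filter.1 he⟩

theorem rim_eq_of_cut_eq_fourCycle (hcut : cut K A = fourCycle a b c d) :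
    rim K A = {a, b, c, d} := by
  ext i
  rw [mem_rim, hcut, exists_mem_fourCycle_iff]

namespace IsSimpleSphere

theorem beltSide_of_cut_eq_powersetCard_two (hK : IsSimpleSphere K) (hA : A ⊆ K)
    (hcut : cut K A = powersetCard 2 S) (hS : #S = 3) (hSK : S ∉ K) : BeltSide K A where
  subset := hA
  not_subset_rim t ht hsub := by
    rw [rim_eq_of_cut_eq_powersetCard_two hcut hS] at hsub
    rw [eq_of_subset_of_card_le hsub (by rw [hS, hK.card_eq t ht])] at ht
    exact hSK ht
  mem_cut_of_subset_rim e he hsub := by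
    rw [rim_eq_of_cut_eq_powersetCard_two hcut hS] at hsub
    rw [hcut, mem_powersetCard]
    exact ⟨hsub, card_of_mem_edges he⟩

theorem beltSide_of_card_cut_eq_three (hK : IsSimpleSphere K) (hA : A ⊆ K) (h3 : #(cut K A) = 3)
    (hone : 1 < #A) (hlt : #A + 1 < #K) : BeltSide K A := by
  obtain ⟨S, hS, hcut⟩ := (hK.isEvenGraph_cut hA).exists_eq_powersetCard_two h3
  refine hK.beltSide_of_cut_eq_powersetCard_two hA hcut hS fun hSK => ?_
  have hSsub : {S} ⊆ K := singleton_subset_iff.2 hSK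
  have hadd := card_sdiff_add_card_eq_card hSsub
  rw [card_singleton] at hadd
  rcases hK.eq_or_eq_sdiff_of_cut_eq hA hSsub (hcut.trans (cut_singleton hSK).symm) with rfl | rfl
  · simp at hone
  · omega

theorem beltSide_of_cut_eq_fourCycle (hK : IsSimpleSphere K) (hA : A ⊆ K)
    (hcut : cut K A = fourCycle a b c d) (hac : {a, c} ∉ edges K) (hbd : {b, d} ∉ edges K) :
    BeltSide K A where
  subset := hA
  not_subset_rim t ht hsub := by
    have hle {x y : ι} (hxy : {x, y} ∉ edges K) : #(t ∩ {x, y}) ≤ 1 := by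
      by_contra! hlt
      have htwo : #({x, y} : Finset ι) ≤ 2 := card_le_two
      have hinter : t ∩ {x, y} = {x, y} := eq_of_subset_of_card_le inter_subset_right (by omega)
      exact hxy (hinter ▸ mem_edges_of_subset ht inter_subset_left
        (le_antisymm (hinter.symm ▸ htwo) hlt))
    have hunion : t ⊆ t ∩ {a, c} ∪ t ∩ {b, d} := by
      rw [rim_eq_of_cut_eq_fourCycle hcut] at hsub
      grind
    have := (card_le_card hunion).trans (card_union_le _ _)
    have := hK.card_eq t ht
    have := hle hac
    have := hle hbd
    omega
  mem_cut_of_subset_rim e he hsub := by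
    rw [rim_eq_of_cut_eq_fourCycle hcut] at hsub
    obtain ⟨x, y, hxy, rfl⟩ := card_eq_two.1 (card_of_mem_edges he)
    rw [hcut, fourCycle]
    simp only [insert_subset_iff, singleton_subset_iff, mem_insert, mem_singleton] at hsub
    have := pair_comm x y
    grind

/-- The four edges leave the pair of vertices joined by the diagonal `{a, c}`. -/
theorem card_eq_two_of_cut_eq_fourCycle (hK : IsSimpleSphere K) (hA : A ⊆ K)
    (hn : [a, b, c, d].Nodup) (hcut : cut K A = fourCycle a b c d)
    (habc : {a, b, c} ∈ K) (hacd : {a, c, d} ∈ K) : #A = 2 ∨ #A + 2 = #K := by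
  obtain ⟨hab, hac, had, hbc, hbd, hcd⟩ := nodup_four_iff.1 hn
  have hT : ({{a, b, c}, {a, c, d}} : VertexFamily ι) ⊆ K := by
    simp [insert_subset_iff, habc, hacd]
  have hT2 : #({{a, b, c}, {a, c, d}} : VertexFamily ι) = 2 := by
    refine card_pair fun h => ?_
    have : b ∈ ({a, c, d} : Finset ι) := h ▸ by simp
    simp [hab.symm, hbc, hbd] at this
  have hcutT : cut K A = cut K {{a, b, c}, {a, c, d}} := by
    have hinner : 0 < #(innerEdges K {{a, b, c}, {a, c, d}}) :=
      card_pos.2 ⟨{a, c}, mem_filter.2 ⟨mem_edges_of_subset habc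
        (by simp [insert_subset_iff]) (card_pair hac),
        by rw [filter_true_of_mem (by simp [insert_subset_iff]), hT2]⟩⟩
    have hcount := hK.two_mul_card_innerEdges hT
    refine eq_of_subset_of_card_le (fun e he => mem_filter.2 ⟨cut_subset _ _ he, ?_⟩) ?_
    · simp only [hcut, fourCycle, mem_insert, mem_singleton] at he
      rcases he with rfl | rfl | rfl | rfl <;>
        simp [filter_insert, filter_singleton, insert_subset_iff, hab.symm, hbc, hbd,
          had.symm, hcd.symm, hbd.symm]
    · rw [hcut, card_fourCycle hn]
      omega
  have hadd := card_sdiff_add_card_eq_card hT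
  rcases hK.eq_or_eq_sdiff_of_cut_eq hA hT hcutT with rfl | rfl
  · exact Or.inl hT2
  · exact Or.inr (by omega)

end IsSimpleSphere

end VertexFamily

namespace VertexFamily

variable {ι : Type*} [DecidableEq ι] {K A : VertexFamily ι} {D : Finset ι} {i x : ι}

/-! ### Pentagons, hexagons and one exceptional facet -/

/-- The exceptional facets are the quadrangles and the heptagons. -/
def IsExceptional (K : VertexFamily ι) (i : ι) : Prop := degree K i = 4 ∨ degree K i = 7

/-- All facets are pentagons and hexagons, except at most one, a quadrangle or a heptagon. -/
structure PentHex (K : VertexFamily ι) : Prop where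
  four_le : ∀ i, 4 ≤ degree K i
  le_seven : ∀ i, degree K i ≤ 7
  unique : ∀ i j, IsExceptional K i → IsExceptional K j → i = j

namespace PentHex

theorem degree_le_six (hP : PentHex K) (hi : ¬IsExceptional K i) : degree K i ≤ 6 := by
  have := hP.le_seven i
  have := not_or.1 hi
  omega

theorem card_filter_isExceptional_le {p : ι → Prop} [DecidablePred p] (hP : PentHex K)
    (hp : ∀ i, p i → IsExceptional K i) : #{i ∈ D | p i} ≤ 1 :=
  card_le_one.2 fun i hi j hj =>
    hP.unique i j (hp i (mem_filter.1 hi).2) (hp j (mem_filter.1 hj).2)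

theorem five_mul_card_le (hP : PentHex K) (D : Finset ι) :
    5 * #D ≤ ∑ i ∈ D, degree K i + 1 := by
  have hone : #{i ∈ D | degree K i = 4} ≤ 1 := hP.card_filter_isExceptional_le fun _ => Or.inl
  have hsum : ∑ i ∈ D, 5 ≤ ∑ i ∈ D, (degree K i + if degree K i = 4 then 1 else 0) := by
    refine sum_le_sum fun i _ => ?_
    have := hP.four_le i
    split_ifs <;> omega
  rw [sum_const, sum_add_distrib, ← card_filter, smul_eq_mul] at hsum
  omega

theorem sum_degree_le (hP : PentHex K) (D : Finset ι) :
    ∑ i ∈ D, degree K i ≤ 6 * #D + 1 := by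
  have hone : #{i ∈ D | degree K i = 7} ≤ 1 := hP.card_filter_isExceptional_le fun _ => Or.inr
  have hsum : ∑ i ∈ D, degree K i ≤ ∑ i ∈ D, (6 + if degree K i = 7 then 1 else 0) := by
    refine sum_le_sum fun i _ => ?_
    have := hP.le_seven i
    split_ifs <;> omega
  rw [sum_add_distrib, sum_const, ← card_filter, smul_eq_mul] at hsum
  omega

theorem weight_add_weight_sdiff_le (hP : PentHex K) (hK : IsSimpleSphere K) (hA : A ⊆ K) :
    weight K A + weight K (K \ A) ≤ 6 * #(cut K A) + 1 := by
  have := hK.weight_add_weight_sdiff hA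
  have := hP.sum_degree_le (rim K A)
  have := hK.card_rim_le hA
  omega

variable [Fintype ι]

theorem not_isExceptional_of_mem_innerFacets_sdiff (hP : PentHex K) (hK : IsSimpleSphere K)
    (hxA : x ∈ innerFacets K A) (hx : IsExceptional K x) (hi : i ∈ innerFacets K (K \ A)) :
    ¬IsExceptional K i :=
  fun h => hK.notMem_innerFacets_sdiff hxA (hP.unique i x h hx ▸ hi)

theorem weight_add_weight_sdiff_le_of_isExceptional (hP : PentHex K) (hK : IsSimpleSphere K)
    (hA : A ⊆ K) (hxA : x ∈ innerFacets K A) (hx : IsExceptional K x) :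
    weight K A + weight K (K \ A) ≤ 6 * #(cut K A) := by
  have hsum := sum_degree_le_of_forall (K := K) (D := rim K A) (n := 6) fun i hi =>
    hP.degree_le_six fun h => hK.notMem_rim_of_mem_innerFacets hA hxA (hP.unique i x h hx ▸ hi)
  have := hK.weight_add_weight_sdiff hA
  have := hK.card_rim_le hA
  omega

end PentHex

section Belts

variable [Nonempty ι]

/-- Compares Euler's formula for the side `A`, where all inner facets but one have at least five
vertices, with the incidence count. -/
theorem BeltSide.two_mul_weight_le [Finite ι] (h : BeltSide K A) (hK : IsSimpleSphere K)
    (hP : PentHex K) (h0 : 0 < #(cut K A)) (h5 : #(cut K A) ≤ 5) :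
    2 * weight K A + 8 ≤ #A + 5 * #(cut K A) := by
  have := Fintype.ofFinite ι
  have := hK.two_mul_card_innerFacets h.subset (h.nonempty hK h0) (h.ne hK h0) h5
  have := hK.sum_degree_add_weight h.subset
  have := hP.five_mul_card_le (innerFacets K A)
  omega

/-! ### Three-belts -/

theorem BeltSide.weight_bounds_of_card_cut_eq_three [Finite ι] (h : BeltSide K A)
    (hK : IsSimpleSphere K) (hP : PentHex K) (h3 : #(cut K A) = 3) :
    weight K A ≤ #(core K A) + 4 ∧ 9 ≤ weight K A := by
  have hweight := h.two_mul_weight_le hK hP (by omega) (by omega)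
  have hcard := h.card_add_card_cut hK
  have hcore := h.card_cut_core_add_le hK
  have := hK.three_le_card_cut ((core_subset K A).trans h.subset) (card_pos.1 (by omega))
    (h.core_ne hK (by omega))
  omega

theorem BeltSide.core_of_weight_le_nine [Finite ι] (h : BeltSide K A) (hK : IsSimpleSphere K)
    (hP : PentHex K) (h3 : #(cut K A) = 3) (h9 : weight K A ≤ 9) :
    BeltSide K (core K A) ∧ #(cut K (core K A)) = 3 := by
  have hcK : core K A ⊆ K := (core_subset K A).trans h.subset
  have hweight := h.weight_bounds_of_card_cut_eq_three hK hP h3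
  have := hK.three_le_card_cut hcK (card_pos.1 (by omega)) (h.core_ne hK (by omega))
  have := h.card_cut_core_add_le hK
  have := h.card_core_add_le hK
  have := card_le_card h.subset
  have h3' : #(cut K (core K A)) = 3 := by omega
  exact ⟨hK.beltSide_of_card_cut_eq_three hcK h3' (by omega) (by omega), h3'⟩

/-- While the weight is `9`, one can pass to the core, which is again a side of a `3`-belt and,
by `weight_mono`, has no larger weight. -/
theorem BeltSide.ten_le_weight [Fintype ι] (h : BeltSide K A) (hK : IsSimpleSphere K)
    (hP : PentHex K) (h3 : #(cut K A) = 3) (hA : ∀ i ∈ innerFacets K A, ¬IsExceptional K i) :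
    10 ≤ weight K A := by
  induction hn : #A using Nat.strong_induction_on generalizing A with
  | _ n ih =>
    by_contra! hlt
    obtain ⟨hB, hB3⟩ := h.core_of_weight_le_nine hK hP h3 (by omega)
    have := h.card_core_add_le hK
    have := ih _ (by omega) hB hB3
      (fun i hi => hA i (innerFacets_mono (core_subset K A) hi)) rfl
    have := hK.weight_mono h.subset (core_subset K A) (hB.nonempty hK (by omega))
      (h.ne hK (by omega)) (by omega) (by omega) fun i hi => hP.degree_le_six (hA i hi)
    omega

theorem BeltSide.not_isExceptional_of_card_cut_eq_three [Fintype ι] (h : BeltSide K A)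
    (hK : IsSimpleSphere K) (hP : PentHex K) (h3 : #(cut K A) = 3) (hi : i ∈ innerFacets K A) :
    ¬IsExceptional K i := by
  intro hexc
  have := hP.weight_add_weight_sdiff_le_of_isExceptional hK h.subset hi hexc
  have := (h.weight_bounds_of_card_cut_eq_three hK hP h3).2
  have := (h.sdiff hK).ten_le_weight hK hP (by rw [hK.cut_sdiff h.subset, h3])
    fun j hj => hP.not_isExceptional_of_mem_innerFacets_sdiff hK hi hexc hj
  omega

theorem PentHex.card_cut_ne_three [Finite ι] (hP : PentHex K) (hK : IsSimpleSphere K)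
    (h : BeltSide K A) : #(cut K A) ≠ 3 := by
  have := Fintype.ofFinite ι
  intro h3
  have h3' : #(cut K (K \ A)) = 3 := by rw [hK.cut_sdiff h.subset, h3]
  have := h.ten_le_weight hK hP h3 fun i hi =>
    h.not_isExceptional_of_card_cut_eq_three hK hP h3 hi
  have := (h.sdiff hK).ten_le_weight hK hP h3' fun i hi =>
    (h.sdiff hK).not_isExceptional_of_card_cut_eq_three hK hP h3' hi
  have := hP.weight_add_weight_sdiff_le hK h.subset
  omega

/-- There are no `3`-belts: three pairwise adjacent facets always have a common vertex. -/
def HasNoThreeBelt (K : VertexFamily ι) : Prop :=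
  ∀ S, #S = 3 → powersetCard 2 S ⊆ edges K → S ∈ K

theorem PentHex.hasNoThreeBelt [Finite ι] (hP : PentHex K) (hK : IsSimpleSphere K) :
    HasNoThreeBelt K := by
  intro S hS hsub
  by_contra hSK
  obtain ⟨A, hA, hcut⟩ := hK.exists_cut_eq hsub (isEvenGraph_powersetCard_two hS)
  refine hP.card_cut_ne_three hK (hK.beltSide_of_cut_eq_powersetCard_two hA hcut hS hSK) ?_
  rw [hcut, card_powersetCard, hS]
  rfl

end Belts

end VertexFamily

namespace VertexFamily

variable {ι : Type*} [DecidableEq ι] {K A : VertexFamily ι} {a b c d i q x y : ι}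

/-! ### Four-belts -/

namespace HasNoThreeBelt

theorem mem (hF : HasNoThreeBelt K) (hab : a ≠ b) (hbc : b ≠ c) (hca : c ≠ a)
    (habE : {a, b} ∈ edges K) (hbcE : {b, c} ∈ edges K) (hcaE : {c, a} ∈ edges K) :
    {a, b, c} ∈ K :=
  hF _ (card_eq_three.2 ⟨a, b, c, hab, hca.symm, hbc, rfl⟩)
    (powersetCard_two_triple_subset habE hbcE hcaE)

theorem card_cut_ne_three (hF : HasNoThreeBelt K) (hK : IsSimpleSphere K) (h : BeltSide K A) :
    #(cut K A) ≠ 3 := by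
  intro h3
  obtain ⟨S, hS, hcut⟩ := (hK.isEvenGraph_cut h.subset).exists_eq_powersetCard_two h3
  exact h.not_subset_rim S (hF S hS (hcut ▸ cut_subset K A))
    (rim_eq_of_cut_eq_powersetCard_two hcut hS).ge

theorem diagonal_notMem_edges (hF : HasNoThreeBelt K) (hK : IsSimpleSphere K) (hA : A ⊆ K)
    (hn : [a, b, c, d].Nodup) (hcut : cut K A = fourCycle a b c d) (h2 : #A ≠ 2)
    (h2' : #A + 2 ≠ #K) : {a, c} ∉ edges K := by
  intro hacE
  obtain ⟨hab, hac, had, hbc, -, hcd⟩ := nodup_four_iff.1 hn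
  have hcycle : fourCycle a b c d ⊆ edges K := hcut ▸ cut_subset K A
  simp only [fourCycle, insert_subset_iff, singleton_subset_iff] at hcycle
  obtain ⟨habE, hbcE, hcdE, hdaE⟩ := hcycle
  have habc := hF.mem hab hbc hac.symm habE hbcE (pair_comm a c ▸ hacE)
  have hacd := hF.mem hac hcd had.symm hacE hcdE hdaE
  exact (hK.card_eq_two_of_cut_eq_fourCycle hA hn hcut habc hacd).elim h2 h2'

theorem beltSide_of_card_cut_eq_four (hF : HasNoThreeBelt K) (hK : IsSimpleSphere K) (hA : A ⊆ K)
    (h4 : #(cut K A) = 4) (h2 : #A ≠ 2) (h2' : #A + 2 ≠ #K) : BeltSide K A := by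
  obtain ⟨a, b, c, d, hn, hcut⟩ := (hK.isEvenGraph_cut hA).exists_eq_fourCycle h4
  exact hK.beltSide_of_cut_eq_fourCycle hA hcut
    (hF.diagonal_notMem_edges hK hA hn hcut h2 h2')
    (hF.diagonal_notMem_edges hK hA (nodup_four_rotate hn)
      (hcut.trans (fourCycle_rotate a b c d).symm) h2 h2')

end HasNoThreeBelt

/-- The vertices of the facet `q`. -/
def star (K : VertexFamily ι) (q : ι) : VertexFamily ι := {t ∈ K | q ∈ t}

theorem IsSimpleSphere.mem_edges_of_mem_rim_star (hK : IsSimpleSphere K)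
    (hx : x ∈ rim K (star K q)) : {q, x} ∈ edges K := by
  obtain ⟨e, he, hxe⟩ := mem_rim.1 hx
  obtain ⟨-, t, ht, u, hu, het, heu⟩ := (hK.mem_cut_iff (filter_subset _ K)).1 he
  obtain ⟨htK, hqt⟩ := mem_filter.1 ht
  obtain ⟨huK, hustar⟩ := mem_sdiff.1 hu
  have hqx : q ≠ x := by
    rintro rfl
    exact hustar (mem_filter.2 ⟨huK, heu hxe⟩)
  exact mem_edges_of_subset htK (by simp [insert_subset_iff, hqt, het hxe]) (card_pair hqx)

section Belts

variable [Nonempty ι]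

namespace BeltSide

theorem eq_star_of_core_eq_empty [Fintype ι] (h : BeltSide K A) (hK : IsSimpleSphere K)
    (hP : PentHex K) (h4 : #(cut K A) = 4) (hcore : core K A = ∅) :
    ∃ q ∈ innerFacets K A, degree K q = 4 ∧ A = star K q := by
  have hweight := h.two_mul_weight_le hK hP (by omega) (by omega)
  have hcard := h.card_add_card_cut hK
  rw [hcore, card_empty] at hcard
  have hcutcore := h.card_cut_core_add_le hK
  have hinner := hK.two_mul_card_innerFacets h.subset (h.nonempty hK (by omega))
    (h.ne hK (by omega)) (by omega)
  have hsum := hK.sum_degree_add_weight h.subset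
  obtain ⟨q, hq⟩ := card_eq_one.1 (show #(innerFacets K A) = 1 by omega)
  rw [hq, sum_singleton] at hsum
  have hqA : q ∈ innerFacets K A := hq ▸ mem_singleton_self q
  have hstar : star K q ⊆ A := fun t ht =>
    mem_innerFacets.1 hqA t (mem_filter.1 ht).1 (mem_filter.1 ht).2
  have hle : #A ≤ #(star K q) := by
    change #A ≤ degree K q
    omega
  exact ⟨q, hqA, by omega, (eq_of_subset_of_card_le hstar hle).symm⟩

theorem core_of_weight_le_twelve [Finite ι] (h : BeltSide K A) (hK : IsSimpleSphere K)
    (hP : PentHex K) (h4 : #(cut K A) = 4) (h12 : weight K A ≤ 12) (hcore : (core K A).Nonempty) :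
    weight K A = 12 ∧ BeltSide K (core K A) ∧ #(cut K (core K A)) = 4 := by
  have hcK : core K A ⊆ K := (core_subset K A).trans h.subset
  have hF := hP.hasNoThreeBelt hK
  have := h.two_mul_weight_le hK hP (by omega) (by omega)
  have := h.card_add_card_cut hK
  have := h.card_cut_core_add_le hK
  have := h.card_core_add_le hK
  have := card_le_card h.subset
  have := hK.three_le_card_cut hcK hcore (h.core_ne hK (by omega))
  have h3 : #(cut K (core K A)) ≠ 3 := fun h3 => hF.card_cut_ne_three hK
    (hK.beltSide_of_card_cut_eq_three hcK h3 (by omega) (by omega)) h3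
  have h4' : #(cut K (core K A)) = 4 := by omega
  exact ⟨by omega, hF.beltSide_of_card_cut_eq_four hK hcK h4' (by omega) (by omega), h4'⟩

theorem thirteen_le_weight [Fintype ι] (h : BeltSide K A) (hK : IsSimpleSphere K)
    (hP : PentHex K) (h4 : #(cut K A) = 4) (hA : ∀ i ∈ innerFacets K A, ¬IsExceptional K i) :
    13 ≤ weight K A := by
  induction hn : #A using Nat.strong_induction_on generalizing A with
  | _ n ih =>
    by_contra! hlt
    rcases (core K A).eq_empty_or_nonempty with hcore | hcore
    · obtain ⟨q, hqA, hq, -⟩ := h.eq_star_of_core_eq_empty hK hP h4 hcore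
      exact hA q hqA (Or.inl hq)
    · obtain ⟨-, hB, hB4⟩ := h.core_of_weight_le_twelve hK hP h4 (by omega) hcore
      have := h.card_core_add_le hK
      have := ih _ (by omega) hB hB4
        (fun i hi => hA i (innerFacets_mono (core_subset K A) hi)) rfl
      have := hK.weight_mono h.subset (core_subset K A) hcore
        (h.ne hK (by omega)) (by omega) (by omega) fun i hi => hP.degree_le_six (hA i hi)
      omega

theorem eq_star_of_isExceptional [Fintype ι] (h : BeltSide K A) (hK : IsSimpleSphere K)
    (hP : PentHex K) (h4 : #(cut K A) = 4) (hxA : x ∈ innerFacets K A) (hx : IsExceptional K x) :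
    ∃ q, degree K q = 4 ∧ A = star K q := by
  have hle := hP.weight_add_weight_sdiff_le_of_isExceptional hK h.subset hxA hx
  have hge := (h.sdiff hK).thirteen_le_weight hK hP (by rw [hK.cut_sdiff h.subset, h4])
    fun i hi => hP.not_isExceptional_of_mem_innerFacets_sdiff hK hxA hx hi
  rcases (core K A).eq_empty_or_nonempty with hcore | hcore
  · obtain ⟨q, -, hq⟩ := h.eq_star_of_core_eq_empty hK hP h4 hcore
    exact ⟨q, hq⟩
  · have := (h.core_of_weight_le_twelve hK hP h4 (by omega) hcore).1
    omega

theorem eq_star_or_sdiff_eq_star [Finite ι] (h : BeltSide K A) (hK : IsSimpleSphere K)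
    (hP : PentHex K) (h4 : #(cut K A) = 4) :
    ∃ q, degree K q = 4 ∧ (A = star K q ∨ K \ A = star K q) := by
  have := Fintype.ofFinite ι
  have hB := h.sdiff hK
  have h4' : #(cut K (K \ A)) = 4 := by rw [hK.cut_sdiff h.subset, h4]
  by_contra! hcontra
  have hge := h.thirteen_le_weight hK hP h4 fun i hi hexc => by
    obtain ⟨q, hq, hstar⟩ := h.eq_star_of_isExceptional hK hP h4 hi hexc
    exact (hcontra q hq).1 hstar
  have hge' := hB.thirteen_le_weight hK hP h4' fun i hi hexc => by
    obtain ⟨q, hq, hstar⟩ := hB.eq_star_of_isExceptional hK hP h4' hi hexc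
    exact (hcontra q hq).2 hstar
  have hle := hP.weight_add_weight_sdiff_le hK h.subset
  omega

end BeltSide

theorem exists_quadrangle_of_fourCycle [Finite ι] (hK : IsSimpleSphere K) (hP : PentHex K)
    (hn : [a, b, c, d].Nodup) (hcycle : fourCycle a b c d ⊆ edges K) (hac : {a, c} ∉ edges K)
    (hbd : {b, d} ∉ edges K) :
    ∃ q, degree K q = 4 ∧ ∀ x ∈ ({a, b, c, d} : Finset ι), {q, x} ∈ edges K := by
  obtain ⟨A, hA, hcut⟩ := hK.exists_cut_eq hcycle (isEvenGraph_fourCycle hn)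
  have h := hK.beltSide_of_cut_eq_fourCycle hA hcut hac hbd
  obtain ⟨q, hq, hstar⟩ := h.eq_star_or_sdiff_eq_star hK hP (by rw [hcut, card_fourCycle hn])
  have hrim : rim K A = rim K (star K q) := by
    rcases hstar with rfl | hstar
    · rfl
    · rw [← hstar, hK.rim_sdiff hA]
  refine ⟨q, hq, fun x hx => hK.mem_edges_of_mem_rim_star (hrim ▸ ?_)⟩
  rwa [rim_eq_of_cut_eq_fourCycle hcut]

end Belts

/-! ### The link of a facet -/

/-- The cyclic sequence of the facets around the facet `q`, as the set of its edges. -/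
def link (K : VertexFamily ι) (q : ι) : Finset (Finset ι) := (star K q).image (·.erase q)

theorem mem_link {e : Finset ι} : e ∈ link K q ↔ q ∉ e ∧ insert q e ∈ K := by
  simp only [link, star, mem_image, mem_filter]
  constructor
  · rintro ⟨t, ⟨ht, hqt⟩, rfl⟩
    exact ⟨notMem_erase q t, (insert_erase hqt).symm ▸ ht⟩
  · rintro ⟨hqe, ht⟩
    exact ⟨_, ⟨ht, mem_insert_self q e⟩, erase_insert hqe⟩

theorem injOn_erase_star (K : VertexFamily ι) (q : ι) :
    Set.InjOn (fun t : Finset ι => t.erase q) (star K q) := fun s hs t ht hst => by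
  rw [← insert_erase (mem_filter.1 hs).2, ← insert_erase (mem_filter.1 ht).2]
  exact congrArg (insert q) hst

theorem card_link (K : VertexFamily ι) (q : ι) : #(link K q) = degree K q :=
  card_image_of_injOn (injOn_erase_star K q)

theorem mem_edges_iff_exists_mem_link : {q, x} ∈ edges K ↔ ∃ e ∈ link K q, x ∈ e := by
  simp only [mem_edges, mem_link]
  constructor
  · rintro ⟨t, ht, hsub, h2⟩
    have hxq : x ≠ q := by
      rintro rfl
      simp at h2
    have hqt : q ∈ t := hsub (mem_insert_self q {x})
    exact ⟨t.erase q, ⟨notMem_erase q t, (insert_erase hqt).symm ▸ ht⟩,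
      mem_erase.2 ⟨hxq, hsub (by simp)⟩⟩
  · rintro ⟨e, ⟨hqe, ht⟩, hxe⟩
    exact ⟨_, ht, insert_subset_insert q (singleton_subset_iff.2 hxe),
      card_pair fun h => hqe (h ▸ hxe)⟩

theorem mem_edges_iff_of_link_eq_fourCycle (hlink : link K q = fourCycle a b c d) :
    {q, x} ∈ edges K ↔ x ∈ ({a, b, c, d} : Finset ι) := by
  rw [mem_edges_iff_exists_mem_link, hlink, exists_mem_fourCycle_iff]

theorem card_link_filter_mem (hiq : i ≠ q) :
    #{e ∈ link K q | i ∈ e} = #{t ∈ K | {q, i} ⊆ t} := by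
  rw [link, filter_image, card_image_of_injOn ((injOn_erase_star K q).mono (filter_subset _ _)),
    star, filter_filter]
  simp [insert_subset_iff, hiq]

namespace IsSimpleSphere

theorem isEvenGraph_link (hK : IsSimpleSphere K) (q : ι) : IsEvenGraph (link K q) where
  card_eq e he := by
    obtain ⟨hqe, ht⟩ := mem_link.1 he
    have := hK.card_eq _ ht
    rw [card_insert_of_notMem hqe] at this
    omega
  even i := by
    by_cases hiq : i = q
    · rw [filter_false_of_mem fun e he hie => (mem_link.1 he).1 (hiq ▸ hie)]
      exact Even.zero
    · rw [card_link_filter_mem hiq]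
      by_cases he : {q, i} ∈ edges K
      · rw [hK.card_ends he]
        exact even_two
      · rw [filter_false_of_mem fun t ht hsub =>
          he (mem_edges_of_subset ht hsub (card_pair (Ne.symm hiq)))]
        exact Even.zero

end IsSimpleSphere

theorem HasNoThreeBelt.mem_link (hF : HasNoThreeBelt K) (hqx : {q, x} ∈ edges K)
    (hqy : {q, y} ∈ edges K) (hxy : {x, y} ∈ edges K) : {x, y} ∈ link K q := by
  have hne {z w : ι} (h : {z, w} ∈ edges K) : z ≠ w := by
    rintro rfl
    simpa using card_of_mem_edges h
  exact VertexFamily.mem_link.2 ⟨by simp [hne hqx, hne hqy],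
    hF.mem (hne hqx) (hne hxy) (hne hqy).symm hqx hxy (pair_comm q y ▸ hqy)⟩

theorem HasNoThreeBelt.exists_link_eq_fourCycle (hF : HasNoThreeBelt K) (hK : IsSimpleSphere K)
    (hq : degree K q = 4) : ∃ a b c d, [a, b, c, d].Nodup ∧ link K q = fourCycle a b c d ∧
      {a, c} ∉ edges K ∧ {b, d} ∉ edges K := by
  obtain ⟨a, b, c, d, hn, hlink⟩ :=
    (hK.isEvenGraph_link q).exists_eq_fourCycle ((card_link K q).trans hq)
  have hdiag {x y : ι} (hx : x ∈ ({a, b, c, d} : Finset ι)) (hy : y ∈ ({a, b, c, d} : Finset ι))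
      (hxy : {x, y} ∉ fourCycle a b c d) : {x, y} ∉ edges K := fun hE =>
    hxy (hlink ▸ hF.mem_link ((mem_edges_iff_of_link_eq_fourCycle hlink).2 hx)
      ((mem_edges_iff_of_link_eq_fourCycle hlink).2 hy) hE)
  obtain ⟨hab, hac, had, hbc, hbd, hcd⟩ := nodup_four_iff.1 hn
  refine ⟨a, b, c, d, hn, hlink, hdiag (by simp) (by simp) ?_, hdiag (by simp) (by simp) ?_⟩ <;>
  grind [fourCycle, pair_eq_pair_iff_eq_or_swap]

end VertexFamily

theorem exists_dual_injOn {E : Type*} [AddCommGroup E] [Module ℝ E] {S : Set E} (hS : S.Finite) :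
    ∃ f : Module.Dual ℝ E, Set.InjOn f S := by
  have := hS.to_subtype
  obtain ⟨f, hf⟩ := Module.exists_dual_forall_apply_ne_zero (K := ℝ)
    (fun p : {p : S × S // p.1 ≠ p.2} => (p.1.1 - p.1.2 : E))
    fun p hp => p.2 (Subtype.ext (sub_eq_zero.1 hp))
  refine ⟨f, fun x hx y hy hxy => ?_⟩
  by_contra hne
  refine hf ⟨(⟨x, hx⟩, ⟨y, hy⟩), fun h => hne (congrArg Subtype.val h)⟩ ?_
  rw [map_sub, hxy, sub_self]

namespace ConvexPolytope

section General

variable {n : ℕ} (P : ConvexPolytope n)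

/-- The affine function defining the `i`-th inequality of the polytope. -/
noncomputable def slack (i : Fin P.m) (x : EuclideanSpace ℝ (Fin n)) : ℝ :=
  inner ℝ (P.a i) x + P.b i

/-- The inequalities that are equalities at `x`. -/
noncomputable def tight (x : EuclideanSpace ℝ (Fin n)) : Finset (Fin P.m) := {i | P.slack i x = 0}

/-- The intersection of the facets with indices in `S`. -/
def face (S : Finset (Fin P.m)) : Set (EuclideanSpace ℝ (Fin n)) :=
  {x | x ∈ P.carrier ∧ S ⊆ P.tight x}

variable {P} {S : Finset (Fin P.m)} {i j : Fin P.m} {u v w x y z : EuclideanSpace ℝ (Fin n)}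

theorem slack_add_smul (t : ℝ) : P.slack i (x + t • u) = P.slack i x + t * inner ℝ (P.a i) u := by
  rw [slack, slack, inner_add_right, inner_smul_right]
  ring

theorem slack_smul_add_smul {s t : ℝ} (hst : s + t = 1) :
    P.slack i (s • x + t • y) = s * P.slack i x + t * P.slack i y := by
  rw [slack, slack, slack, inner_add_right, inner_smul_right, inner_smul_right]
  linear_combination -P.b i * hst

theorem inner_sub_eq_slack_sub : inner ℝ (P.a i) (x - y) = P.slack i x - P.slack i y := by
  rw [slack, slack, inner_sub_right]
  ring

theorem mem_tight : i ∈ P.tight x ↔ P.slack i x = 0 := by simp [tight]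

theorem slack_nonneg (hx : x ∈ P.carrier) (i : Fin P.m) : 0 ≤ P.slack i x := hx i

theorem slack_pos (hx : x ∈ P.carrier) (hi : i ∉ P.tight x) : 0 < P.slack i x :=
  (slack_nonneg hx i).lt_of_ne' (mt mem_tight.2 hi)

theorem mem_facet : x ∈ P.facet i ↔ x ∈ P.carrier ∧ i ∈ P.tight x := by
  rw [mem_tight]
  rfl

theorem carrier_inter_iInter_facet (S : Finset (Fin P.m)) :
    P.carrier ∩ ⋂ i ∈ S, P.facet i = P.face S := by
  ext x
  simp only [Set.mem_inter_iff, Set.mem_iInter, mem_facet, face, Set.mem_ofPred_eq]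
  exact ⟨fun h => ⟨h.1, fun i hi => (h.2 i hi).2⟩, fun h => ⟨h.1, fun i hi => ⟨h.1, h.2 hi⟩⟩⟩

theorem isFace_iff {G : Set (EuclideanSpace ℝ (Fin n))} : P.IsFace G ↔ ∃ S, G = P.face S := by
  simp only [IsFace, carrier_inter_iInter_facet]

theorem facet_inter_facet (i j : Fin P.m) : P.facet i ∩ P.facet j = P.face {i, j} := by
  ext x
  simp only [Set.mem_inter_iff, mem_facet, face, Set.mem_ofPred_eq, insert_subset_iff,
    singleton_subset_iff]
  tauto

theorem isCompact_carrier (P : ConvexPolytope n) : IsCompact P.carrier := by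
  refine Metric.isCompact_of_isClosed_isBounded ?_ P.bounded
  simp only [carrier, Set.ofPred_forall]
  exact isClosed_iInter fun i => isClosed_le continuous_const (by fun_prop)

theorem convex_face (S : Finset (Fin P.m)) : Convex ℝ (P.face S) := by
  intro x hx y hy s t hs ht hst
  refine ⟨fun i => ?_, fun i hi => mem_tight.2 ?_⟩
  · refine (add_nonneg (mul_nonneg hs (slack_nonneg hx.1 i))
      (mul_nonneg ht (slack_nonneg hy.1 i))).trans_eq ?_
    exact (slack_smul_add_smul hst).symm
  · rw [slack_smul_add_smul hst, mem_tight.1 (hx.2 hi), mem_tight.1 (hy.2 hi)]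
    ring

theorem tight_of_mem_openSegment (hv : v ∈ P.carrier) (hw : w ∈ P.carrier)
    (hx : x ∈ openSegment ℝ v w) : P.tight x = P.tight v ∩ P.tight w := by
  obtain ⟨s, t, hs, ht, hst, rfl⟩ := hx
  ext i
  rw [mem_inter, mem_tight, mem_tight, mem_tight, slack_smul_add_smul hst,
    add_eq_zero_iff_of_nonneg (mul_nonneg hs.le (slack_nonneg hv i))
      (mul_nonneg ht.le (slack_nonneg hw i)),
    mul_eq_zero_iff_left hs.ne', mul_eq_zero_iff_left ht.ne']

/-- The segment from an interior point to a point violating only the `i`-th inequality leaves the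
polytope through the `i`-th facet. -/
theorem facet_nonempty (i : Fin P.m) : (P.facet i).Nonempty := by
  obtain ⟨y, hy⟩ := P.fullDim
  have hy : y ∈ P.carrier := interior_subset hy
  obtain ⟨x, hx, hxi⟩ : ∃ x, (∀ j, j ≠ i → 0 ≤ P.slack j x) ∧ P.slack i x < 0 := by
    by_contra! hcon
    refine P.irredundant i (Set.Subset.antisymm (fun x hx j => ?_) fun x hx j _ => hx j)
    rcases eq_or_ne j i with rfl | hj
    exacts [hcon x hx, hx j hj]
  have hyi := slack_nonneg hy i
  have hpos : 0 < P.slack i y - P.slack i x := by linarith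
  set s := P.slack i y / (P.slack i y - P.slack i x)
  have hs : 0 ≤ s := div_nonneg hyi hpos.le
  have hs1 : s ≤ 1 := (div_le_one hpos).2 (by linarith)
  have hzero : P.slack i (s • x + (1 - s) • y) = 0 := by
    rw [slack_smul_add_smul (by ring)]
    simp only [s]
    field_simp
    ring
  refine ⟨s • x + (1 - s) • y, fun j => ?_, hzero⟩
  rcases eq_or_ne j i with rfl | hj
  · exact hzero.ge
  · refine le_of_le_of_eq ?_ (slack_smul_add_smul (by ring)).symm
    exact add_nonneg (mul_nonneg hs (hx j hj)) (mul_nonneg (by linarith) (slack_nonneg hy j))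

theorem exists_add_smul_mem (hx : x ∈ P.carrier)
    (hu : ∀ i ∈ P.tight x, 0 ≤ inner ℝ (P.a i) u) : ∃ ε : ℝ, 0 < ε ∧ x + ε • u ∈ P.carrier := by
  suffices h : ∀ᶠ ε in nhdsWithin (0 : ℝ) (Set.Ioi 0), ∀ i, 0 ≤ P.slack i (x + ε • u) by
    obtain ⟨ε, hε, hpos⟩ := (h.and self_mem_nhdsWithin).exists
    exact ⟨ε, hpos, hε⟩
  rw [Filter.eventually_all]
  intro i
  simp only [slack_add_smul]
  by_cases hi : i ∈ P.tight x
  · filter_upwards [self_mem_nhdsWithin] with ε hε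
    rw [mem_tight.1 hi, zero_add]
    exact mul_nonneg (Set.mem_Ioi.1 hε).le (hu i hi)
  · have hcont : Continuous fun ε : ℝ => P.slack i x + ε * inner ℝ (P.a i) u := by fun_prop
    have hlt := (hcont.tendsto 0).eventually_const_lt (by simpa using slack_pos hx hi)
    exact (hlt.filter_mono nhdsWithin_le_nhds).mono fun ε hε => hε.le

theorem exists_exit (hx : x ∈ P.carrier) (hu : u ≠ 0) :
    ∃ t : ℝ, 0 ≤ t ∧ x + t • u ∈ P.carrier ∧
      ∃ i ∈ P.tight (x + t • u), inner ℝ (P.a i) u < 0 := by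
  have hcompact : IsCompact (Set.Ici 0 ∩ (fun t : ℝ => x + t • u) ⁻¹' P.carrier) :=
    (((Homeomorph.addLeft x).isClosedEmbedding.comp
      (isClosedEmbedding_smul_left hu)).isCompact_preimage P.isCompact_carrier).inter_left
        isClosed_Ici
  obtain ⟨t, ⟨ht0, ht⟩, hmax⟩ := hcompact.exists_isGreatest ⟨0, by simpa using hx⟩
  refine ⟨t, ht0, ht, ?_⟩
  by_contra! hcon
  obtain ⟨ε, hε, hmem⟩ := exists_add_smul_mem ht hcon
  have hle : t + ε ≤ t := hmax ⟨add_nonneg ht0 hε.le, by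
    rwa [Set.mem_preimage, add_smul, ← add_assoc]⟩
  linarith

theorem isVertex_iff : P.IsVertex v ↔
    v ∈ P.carrier ∧ ∀ u, (∀ i ∈ P.tight v, inner ℝ (P.a i) u = 0) → u = 0 := by
  rw [IsVertex, isFace_iff]
  constructor
  · rintro ⟨S, hS⟩
    have hv : v ∈ P.face S := hS ▸ rfl
    refine ⟨hv.1, fun u hu => ?_⟩
    obtain ⟨ε, hε, hmem⟩ := exists_add_smul_mem hv.1 fun i hi => (hu i hi).ge
    have hface : v + ε • u ∈ P.face S := ⟨hmem, fun i hi => mem_tight.2 <| by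
      rw [slack_add_smul, hu i (hv.2 hi), mem_tight.1 (hv.2 hi), mul_zero, add_zero]⟩
    rw [← hS, Set.mem_singleton_iff, add_eq_left, smul_eq_zero] at hface
    exact hface.resolve_left hε.ne'
  · rintro ⟨hv, h⟩
    refine ⟨P.tight v, Set.Subset.antisymm ?_ ?_⟩
    · rintro _ rfl
      exact ⟨hv, Subset.rfl⟩
    · rintro x ⟨-, hsub⟩
      refine sub_eq_zero.1 (h _ fun i hi => ?_)
      rw [inner_sub_eq_slack_sub, mem_tight.1 hi, mem_tight.1 (hsub hi), sub_zero]

theorem IsVertex.mem_carrier (hv : P.IsVertex v) : v ∈ P.carrier := (isVertex_iff.1 hv).1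

theorem IsVertex.eq_zero (hv : P.IsVertex v) (h : ∀ i ∈ P.tight v, inner ℝ (P.a i) u = 0) :
    u = 0 :=
  (isVertex_iff.1 hv).2 u h

theorem IsVertex.eq_of_tight_subset (hv : P.IsVertex v) (h : P.tight v ⊆ P.tight x) : x = v := by
  refine sub_eq_zero.1 (hv.eq_zero fun i hi => ?_)
  rw [inner_sub_eq_slack_sub, mem_tight.1 hi, mem_tight.1 (h hi), sub_zero]

theorem injOn_tight (P : ConvexPolytope n) : Set.InjOn P.tight {v | P.IsVertex v} :=
  fun _ _ _ hw h => IsVertex.eq_of_tight_subset hw h.ge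

theorem exists_isVertex (hx : x ∈ P.carrier) : ∃ v, P.IsVertex v ∧ P.tight x ⊆ P.tight v := by
  induction hk : P.m - #(P.tight x) using Nat.strong_induction_on generalizing x with
  | _ k ih =>
    by_cases hv : P.IsVertex x
    · exact ⟨x, hv, Subset.rfl⟩
    rw [isVertex_iff] at hv
    push Not at hv
    obtain ⟨u, hu, hu0⟩ := hv hx
    obtain ⟨t, -, ht, i, hi, hneg⟩ := exists_exit hx hu0
    have hsub : P.tight x ⊆ P.tight (x + t • u) := fun j hj => by
      rw [mem_tight, slack_add_smul, hu j hj, mem_tight.1 hj, mul_zero, add_zero]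
    have hlt := card_lt_card ⟨hsub, fun h => hneg.ne (hu i (h hi))⟩
    have hle : #(P.tight (x + t • u)) ≤ P.m := (card_le_univ _).trans_eq (Fintype.card_fin _)
    obtain ⟨v, hv, hsub'⟩ := ih _ (by omega) ht rfl
    exact ⟨v, hv, hsub.trans hsub'⟩

theorem IsSimple.card_tight (hP : P.IsSimple) (hv : P.IsVertex v) : #(P.tight v) = n := by
  refine Eq.trans ?_ (hP v hv)
  rw [← Set.ncard_coe_finset]
  congr 1
  ext i
  simp [mem_facet, hv.mem_carrier]

theorem IsSimple.exists_inner_eq_one (hP : P.IsSimple) (hv : P.IsVertex v) (hi : i ∈ P.tight v) :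
    ∃ u, inner ℝ (P.a i) u = 1 ∧ ∀ j ∈ P.tight v, j ≠ i → inner ℝ (P.a j) u = 0 := by
  let φ : EuclideanSpace ℝ (Fin n) →ₗ[ℝ] (P.tight v → ℝ) :=
    LinearMap.pi fun j => (innerSL ℝ (P.a j)).toLinearMap
  have hinj : Function.Injective φ := (injective_iff_map_eq_zero φ).2 fun u hu =>
    hv.eq_zero fun j hj => congrFun hu ⟨j, hj⟩
  have hsurj : Function.Surjective φ :=
    (LinearMap.injective_iff_surjective_of_finrank_eq_finrank (by simp [hP.card_tight hv])).1 hinj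
  obtain ⟨u, hu⟩ := hsurj (Pi.single ⟨i, hi⟩ 1)
  refine ⟨u, (congrFun hu ⟨i, hi⟩).trans (Pi.single_eq_same _ _), fun j hj hji => ?_⟩
  exact (congrFun hu ⟨j, hj⟩).trans (Pi.single_eq_of_ne (by simpa using hji) _)

/-- The vertex `w` is the other end of the edge from `v` that leaves the `i`-th facet. -/
structure IsNeighbor (P : ConvexPolytope n) (v : EuclideanSpace ℝ (Fin n)) (i : Fin P.m)
    (w : EuclideanSpace ℝ (Fin n)) : Prop where
  isVertex : P.IsVertex w
  notMem : i ∉ P.tight w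
  erase_subset : (P.tight v).erase i ⊆ P.tight w

theorem IsSimple.exists_isNeighbor (hP : P.IsSimple) (hv : P.IsVertex v) (hi : i ∈ P.tight v) :
    ∃ w, P.IsNeighbor v i w := by
  obtain ⟨d, hdi, hd⟩ := hP.exists_inner_eq_one hv hi
  have hd0 : d ≠ 0 := by
    rintro rfl
    simp at hdi
  obtain ⟨t, ht0, ht, l, hl, hneg⟩ := exists_exit hv.mem_carrier hd0
  have htpos : 0 < t := by
    refine ht0.lt_of_ne ?_
    rintro rfl
    rw [zero_smul, add_zero] at hl
    rcases eq_or_ne l i with rfl | hli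
    · linarith
    · exact hneg.ne (hd l hl hli)
  have hsub : (P.tight v).erase i ⊆ P.tight (v + t • d) := fun j hj => by
    obtain ⟨hji, hj⟩ := mem_erase.1 hj
    rw [mem_tight, slack_add_smul, hd j hj hji, mem_tight.1 hj, mul_zero, add_zero]
  refine ⟨v + t • d, isVertex_iff.2 ⟨ht, fun u hu => ?_⟩, ?_, hsub⟩
  · have hud : u - inner ℝ (P.a i) u • d = 0 := hv.eq_zero fun j hj => by
      rw [inner_sub_right, inner_smul_right]
      rcases eq_or_ne j i with rfl | hji
      · rw [hdi, mul_one, sub_self]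
      · rw [hu j (hsub (mem_erase.2 ⟨hji, hj⟩)), hd j hj hji, mul_zero, sub_zero]
    rw [sub_eq_zero] at hud
    have hlu := hu l hl
    rw [hud, inner_smul_right, mul_eq_zero_iff_right hneg.ne] at hlu
    rw [hud, hlu, zero_smul]
  · rw [mem_tight, slack_add_smul, mem_tight.1 hi, hdi]
    linarith

/-- The edges at a vertex of a simple polytope span the cone of the polytope at this vertex. -/
theorem IsVertex.sub_eq_sum (hv : P.IsVertex v) {w : Fin P.m → EuclideanSpace ℝ (Fin n)}
    (hw : ∀ i ∈ P.tight v, P.IsNeighbor v i (w i)) (x : EuclideanSpace ℝ (Fin n)) :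
    x - v = ∑ i ∈ P.tight v, (P.slack i x / P.slack i (w i)) • (w i - v) := by
  refine sub_eq_zero.1 (hv.eq_zero fun j hj => ?_)
  rw [inner_sub_right, inner_sum, sum_eq_single_of_mem j hj, inner_smul_right,
    inner_sub_eq_slack_sub, inner_sub_eq_slack_sub, mem_tight.1 hj, sub_zero, sub_zero,
    div_mul_cancel₀ _ (mt mem_tight.2 (hw j hj).notMem), sub_self]
  intro i hi hij
  rw [inner_smul_right, inner_sub_eq_slack_sub, mem_tight.1 hj,
    mem_tight.1 ((hw i hi).erase_subset (mem_erase.2 ⟨hij.symm, hj⟩)), sub_zero, mul_zero]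

namespace IsNeighbor

theorem mem_face (h : P.IsNeighbor v i w) : w ∈ P.face ((P.tight v).erase i) :=
  ⟨h.isVertex.mem_carrier, h.erase_subset⟩

theorem ne (h : P.IsNeighbor v i w) (hi : i ∈ P.tight v) : w ≠ v := by
  rintro rfl
  exact h.notMem hi

theorem tight_of_mem_openSegment (h : P.IsNeighbor v i w) (hv : P.IsVertex v)
    (hx : x ∈ openSegment ℝ v w) : P.tight x = (P.tight v).erase i := by
  rw [ConvexPolytope.tight_of_mem_openSegment hv.mem_carrier h.isVertex.mem_carrier hx]
  ext j
  rw [mem_inter, mem_erase]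
  refine ⟨fun hj => ⟨?_, hj.1⟩, fun hj => ⟨hj.2, h.erase_subset (mem_erase.2 hj)⟩⟩
  rintro rfl
  exact h.notMem hj.2

theorem face_eq_segment (h : P.IsNeighbor v i w) (hv : P.IsVertex v) (hi : i ∈ P.tight v) :
    P.face ((P.tight v).erase i) = segment ℝ v w := by
  refine Set.Subset.antisymm (fun z hz => ?_) ((convex_face _).segment_subset
    ⟨hv.mem_carrier, Finset.erase_subset _ _⟩ h.mem_face)
  have hpos := slack_pos h.isVertex.mem_carrier h.notMem
  set c := P.slack i z / P.slack i w
  have hc0 : 0 ≤ c := div_nonneg (hz.1 i) hpos.le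
  have hzc : z - v = c • (w - v) := by
    refine sub_eq_zero.1 (hv.eq_zero fun j hj => ?_)
    rw [inner_sub_right, inner_smul_right, inner_sub_eq_slack_sub, inner_sub_eq_slack_sub,
      mem_tight.1 hj, sub_zero, sub_zero]
    rcases eq_or_ne j i with rfl | hji
    · rw [div_mul_cancel₀ _ hpos.ne', sub_self]
    · have hj' := mem_erase.2 ⟨hji, hj⟩
      rw [mem_tight.1 (hz.2 hj'), mem_tight.1 (h.erase_subset hj'), mul_zero, sub_zero]
  have hc1 : c ≤ 1 := by
    by_contra! hlt
    have hw : w ∈ openSegment ℝ v z := by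
      refine ⟨1 - c⁻¹, c⁻¹, sub_pos.2 (inv_lt_one_of_one_lt₀ hlt), by positivity, by ring, ?_⟩
      rw [sub_eq_iff_eq_add.1 hzc, smul_add, smul_smul, inv_mul_cancel₀ (by positivity)]
      module
    have hsub := ConvexPolytope.tight_of_mem_openSegment hv.mem_carrier hz.1 hw
    exact h.ne hi (h.isVertex.eq_of_tight_subset (hsub ▸ inter_subset_left)).symm
  refine ⟨1 - c, c, sub_nonneg.2 hc1, hc0, by ring, ?_⟩
  rw [sub_eq_iff_eq_add.1 hzc]
  module

end IsNeighbor

/-- The vertices of a polytope, each given by the set of the facets through it. -/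
noncomputable def vertexFamily (P : ConvexPolytope n) : VertexFamily (Fin P.m) := by
  classical exact ({t | ∃ v, P.IsVertex v ∧ P.tight v = t} : Finset (Finset (Fin P.m)))

theorem mem_vertexFamily {t : Finset (Fin P.m)} :
    t ∈ P.vertexFamily ↔ ∃ v, P.IsVertex v ∧ P.tight v = t := by simp [vertexFamily]

theorem IsVertex.tight_mem_vertexFamily (hv : P.IsVertex v) : P.tight v ∈ P.vertexFamily :=
  mem_vertexFamily.2 ⟨v, hv, rfl⟩

theorem finite_setOf_isVertex (P : ConvexPolytope n) : {v | P.IsVertex v}.Finite :=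
  Set.Finite.of_finite_image (Set.toFinite _) P.injOn_tight

theorem IsNeighbor.filter_vertexFamily (h : P.IsNeighbor v i w) (hv : P.IsVertex v)
    (hi : i ∈ P.tight v) :
    {s ∈ P.vertexFamily | (P.tight v).erase i ⊆ s} = {P.tight v, P.tight w} := by
  ext s
  simp only [mem_filter, mem_insert, mem_singleton]
  constructor
  · rintro ⟨hs, hsub⟩
    obtain ⟨z, hz, rfl⟩ := mem_vertexFamily.1 hs
    have hmem : z ∈ segment ℝ v w := h.face_eq_segment hv hi ▸ ⟨hz.mem_carrier, hsub⟩
    rw [← insert_endpoints_openSegment] at hmem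
    rcases hmem with rfl | rfl | hmem
    · exact Or.inl rfl
    · exact Or.inr rfl
    · have hle : P.tight z ⊆ P.tight v := (h.tight_of_mem_openSegment hv hmem).trans_subset
        (Finset.erase_subset _ _)
      exact Or.inl (by rw [hz.eq_of_tight_subset hle])
  · rintro (rfl | rfl)
    · exact ⟨hv.tight_mem_vertexFamily, Finset.erase_subset _ _⟩
    · exact ⟨h.isVertex.tight_mem_vertexFamily, h.erase_subset⟩

/-- The vertex lying exactly on the facets in `t`. It is arbitrary if there is none. -/
noncomputable def vertexAt (P : ConvexPolytope n) (t : Finset (Fin P.m)) :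
    EuclideanSpace ℝ (Fin n) :=
  Function.invFunOn P.tight {v | P.IsVertex v} t

theorem IsVertex.vertexAt_tight (hv : P.IsVertex v) : P.vertexAt (P.tight v) = v :=
  P.injOn_tight.leftInvOn_invFunOn hv

theorem IsSimple.pivotsUp (hP : P.IsSimple) (f : Module.Dual ℝ (EuclideanSpace ℝ (Fin n))) :
    VertexFamily.PivotsUp P.vertexFamily fun t => f (P.vertexAt t) := by
  intro t ht u hu hlt
  obtain ⟨v, hv, rfl⟩ := mem_vertexFamily.1 ht
  obtain ⟨z, hz, rfl⟩ := mem_vertexFamily.1 hu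
  simp only [hv.vertexAt_tight, hz.vertexAt_tight] at hlt
  choose! w hw using fun i (hi : i ∈ P.tight v) => hP.exists_isNeighbor hv hi
  obtain ⟨i, hi, hpos⟩ : ∃ i ∈ P.tight v,
      0 < P.slack i z / P.slack i (w i) * (f (w i) - f v) := by
    by_contra! hcon
    have hsum := congrArg f (hv.sub_eq_sum hw z)
    simp only [map_sub, map_sum, map_smul, smul_eq_mul] at hsum
    linarith [sum_nonpos hcon]
  have hratio : 0 ≤ P.slack i z / P.slack i (w i) := div_nonneg (slack_nonneg hz.mem_carrier i)
    (slack_nonneg (hw i hi).isVertex.mem_carrier i)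
  refine ⟨_, (hw i hi).isVertex.tight_mem_vertexFamily, i, hi, ?_, (hw i hi).erase_subset, ?_⟩
  · intro hiz
    simp [mem_tight.1 hiz] at hpos
  · simp only [hv.vertexAt_tight, (hw i hi).isVertex.vertexAt_tight]
    exact sub_pos.1 (pos_of_mul_pos_right hpos hratio)

theorem face_nonempty_iff : (P.face S).Nonempty ↔ ∃ t ∈ P.vertexFamily, S ⊆ t := by
  constructor
  · rintro ⟨x, hx, hS⟩
    obtain ⟨v, hv, hsub⟩ := exists_isVertex hx
    exact ⟨_, hv.tight_mem_vertexFamily, hS.trans hsub⟩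
  · rintro ⟨t, ht, hS⟩
    obtain ⟨v, hv, rfl⟩ := mem_vertexFamily.1 ht
    exact ⟨v, hv.mem_carrier, hS⟩

/-- The edges from a vertex `v` inside the face of `S` are linearly independent, so that the
dimension of the face is at least their number. -/
theorem IsSimple.card_tight_sdiff_of_finrank_eq_one (hP : P.IsSimple) (hv : P.IsVertex v)
    (hS : S ⊆ P.tight v) (hdim : Module.finrank ℝ (vectorSpan ℝ (P.face S)) = 1) :
    #(P.tight v \ S) = 1 := by
  have hvS : v ∈ P.face S := ⟨hv.mem_carrier, hS⟩
  refine le_antisymm (card_le_one.2 fun i hi j hj => ?_) (card_pos.2 ?_)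
  · obtain ⟨u, hu⟩ := (collinear_iff_of_mem hvS).1 (collinear_iff_finrank_le_one.2 hdim.le)
    have hneighbor : ∀ k ∈ P.tight v \ S, ∃ w, P.IsNeighbor v k w ∧ ∃ r : ℝ, w = v + r • u := by
      intro k hk
      obtain ⟨hkv, hkS⟩ := mem_sdiff.1 hk
      obtain ⟨w, hw⟩ := hP.exists_isNeighbor hv hkv
      obtain ⟨r, hr⟩ := hu w ⟨hw.isVertex.mem_carrier, fun l hl =>
        hw.erase_subset (mem_erase.2 ⟨fun h => hkS (h ▸ hl), hS hl⟩)⟩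
      exact ⟨w, hw, r, by rw [hr, vadd_eq_add, add_comm]⟩
    obtain ⟨w, hw, r, rfl⟩ := hneighbor i hi
    obtain ⟨w', hw', r', rfl⟩ := hneighbor j hj
    have hiv := (mem_sdiff.1 hi).1
    by_contra hij
    have hr' := mem_tight.1 (hw'.erase_subset (mem_erase.2 ⟨hij, hiv⟩))
    have hr := mt mem_tight.2 hw.notMem
    rw [slack_add_smul, mem_tight.1 hiv, zero_add] at hr hr'
    rw [(mul_eq_zero.1 hr').resolve_right (right_ne_zero_of_mul hr), zero_smul, add_zero] at hw'
    exact hw'.notMem (mem_sdiff.1 hj).1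
  · rw [sdiff_nonempty]
    intro hle
    have hface : P.face S = {v} := Set.Subset.antisymm
      (fun x hx => hv.eq_of_tight_subset (hle.trans hx.2)) (Set.singleton_subset_iff.2 hvS)
    rw [hface, vectorSpan_singleton, finrank_bot] at hdim
    exact zero_ne_one hdim

theorem IsNeighbor.finrank_vectorSpan_face (h : P.IsNeighbor v i w) (hv : P.IsVertex v)
    (hi : i ∈ P.tight v) :
    Module.finrank ℝ (vectorSpan ℝ (P.face ((P.tight v).erase i))) = 1 := by
  rw [h.face_eq_segment hv hi, vectorSpan_segment]
  exact finrank_span_singleton (vsub_ne_zero.2 (h.ne hi))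

end General

open VertexFamily

variable {P : ConvexPolytope 3} {i j : Fin P.m}

theorem IsSimple.isSimpleSphere (hP : P.IsSimple) : IsSimpleSphere P.vertexFamily where
  card_eq := by
    intro t ht
    obtain ⟨v, hv, rfl⟩ := mem_vertexFamily.1 ht
    exact hP.card_tight hv
  cover := by
    intro i
    obtain ⟨x, hx⟩ := facet_nonempty i
    rw [mem_facet] at hx
    obtain ⟨v, hv, hsub⟩ := exists_isVertex hx.1
    exact ⟨_, hv.tight_mem_vertexFamily, hsub hx.2⟩
  card_star := by
    intro t ht i hi
    obtain ⟨v, hv, rfl⟩ := mem_vertexFamily.1 ht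
    obtain ⟨w, hw⟩ := hP.exists_isNeighbor hv hi
    rw [hw.filter_vertexFamily hv hi, card_pair]
    exact fun h => hw.notMem (h ▸ hi)
  exists_height := by
    obtain ⟨f, hf⟩ := exists_dual_injOn P.finite_setOf_isVertex
    refine ⟨fun t => f (P.vertexAt t), fun s hs t ht hst => ?_, hP.pivotsUp f, hP.pivotsUp (-f)⟩
    obtain ⟨v, hv, rfl⟩ := mem_vertexFamily.1 hs
    obtain ⟨w, hw, rfl⟩ := mem_vertexFamily.1 ht
    simp only [hv.vertexAt_tight, hw.vertexAt_tight] at hst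
    rw [hf hv hw hst]

theorem IsSimple.exists_isNeighbor_of_mem_edges (hP : P.IsSimple) {e : Finset (Fin P.m)}
    (he : e ∈ edges P.vertexFamily) :
    ∃ v i w, P.IsVertex v ∧ i ∈ P.tight v ∧ P.IsNeighbor v i w ∧ e = (P.tight v).erase i := by
  obtain ⟨t, ht, i, hi, rfl⟩ := hP.isSimpleSphere.exists_eq_erase he
  obtain ⟨v, hv, rfl⟩ := mem_vertexFamily.1 ht
  obtain ⟨w, hw⟩ := hP.exists_isNeighbor hv hi
  exact ⟨v, i, w, hv, hi, hw, rfl⟩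

theorem IsSimple.exists_mem_face_tight_eq (hP : P.IsSimple) {e : Finset (Fin P.m)}
    (he : e ∈ edges P.vertexFamily) : ∃ x ∈ P.face e, P.tight x = e := by
  obtain ⟨v, i, w, hv, hi, hw, rfl⟩ := hP.exists_isNeighbor_of_mem_edges he
  have hmid := midpoint_mem_openSegment (𝕜 := ℝ) v w
  refine ⟨_, ?_, hw.tight_of_mem_openSegment hv hmid⟩
  rw [hw.face_eq_segment hv hi]
  exact openSegment_subset_segment _ _ _ hmid

theorem IsSimple.face_subset_facet_iff (hP : P.IsSimple) {e : Finset (Fin P.m)}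
    (he : e ∈ edges P.vertexFamily) : P.face e ⊆ P.facet i ↔ i ∈ e := by
  refine ⟨fun h => ?_, fun hi x hx => mem_facet.2 ⟨hx.1, hx.2 hi⟩⟩
  obtain ⟨x, hx, hxe⟩ := hP.exists_mem_face_tight_eq he
  exact hxe ▸ (mem_facet.1 (h hx)).2

theorem IsSimple.injOn_face (hP : P.IsSimple) : Set.InjOn P.face (edges P.vertexFamily) := by
  intro e he e' he' h
  obtain ⟨x, hx, hxe⟩ := hP.exists_mem_face_tight_eq he
  have hx' : x ∈ P.face e' := h ▸ hx
  refine (eq_of_subset_of_card_le (hxe ▸ hx'.2) ?_).symm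
  rw [card_of_mem_edges he, card_of_mem_edges he']

theorem IsSimple.isEdge_face_iff (hP : P.IsSimple) {S : Finset (Fin P.m)} :
    P.IsEdge (P.face S) ↔ S ∈ edges P.vertexFamily := by
  refine ⟨fun h => ?_, fun h => ⟨isFace_iff.2 ⟨S, rfl⟩, ?_⟩⟩
  · have hne : (P.face S).Nonempty := by
      by_contra hempty
      have hdim := h.2
      rw [Set.not_nonempty_iff_eq_empty.1 hempty, vectorSpan_empty, finrank_bot] at hdim
      exact zero_ne_one hdim
    obtain ⟨t, ht, hSt⟩ := face_nonempty_iff.1 hne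
    obtain ⟨v, hv, rfl⟩ := mem_vertexFamily.1 ht
    have hcard := card_sdiff_add_card_eq_card hSt
    rw [hP.card_tight_sdiff_of_finrank_eq_one hv hSt h.2, hP.card_tight hv] at hcard
    exact mem_edges_of_subset ht hSt (by omega)
  · obtain ⟨v, i, w, hv, hi, hw, rfl⟩ := hP.exists_isNeighbor_of_mem_edges h
    exact hw.finrank_vectorSpan_face hv hi

theorem IsSimple.isEdge_facet_inter_iff (hP : P.IsSimple) :
    P.IsEdge (P.facet i ∩ P.facet j) ↔ {i, j} ∈ edges P.vertexFamily := by
  rw [facet_inter_facet, hP.isEdge_face_iff]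

theorem facet_inter_nonempty_iff (hij : i ≠ j) :
    (P.facet i ∩ P.facet j).Nonempty ↔ {i, j} ∈ edges P.vertexFamily := by
  simp only [facet_inter_facet, face_nonempty_iff, mem_edges, card_pair hij, and_true]

theorem IsSimple.edgesOf_eq_image (hP : P.IsSimple) (i : Fin P.m) :
    P.edgesOf i =
      P.face '' ({e ∈ edges P.vertexFamily | i ∈ e} : Finset (Finset (Fin P.m))) := by
  ext G
  simp only [edgesOf, Set.mem_ofPred_eq, Set.mem_image, coe_filter]
  constructor
  · rintro ⟨hG, hGi⟩
    obtain ⟨e, rfl⟩ := isFace_iff.1 hG.1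
    have he := hP.isEdge_face_iff.1 hG
    exact ⟨e, ⟨he, (hP.face_subset_facet_iff he).1 hGi⟩, rfl⟩
  · rintro ⟨e, ⟨he, hi⟩, rfl⟩
    exact ⟨hP.isEdge_face_iff.2 he, (hP.face_subset_facet_iff he).2 hi⟩

theorem IsSimple.isGon_iff (hP : P.IsSimple) {k : ℕ} :
    P.IsGon k i ↔ degree P.vertexFamily i = k := by
  rw [IsGon, hP.edgesOf_eq_image, (hP.injOn_face.mono (filter_subset _ _)).ncard_image,
    Set.ncard_coe_finset, hP.isSimpleSphere.card_edges_mem_eq_degree]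

end ConvexPolytope

theorem forall_zmod_four {p : ZMod 4 → Prop} : (∀ j, p j) ↔ p 0 ∧ p 1 ∧ p 2 ∧ p 3 := by
  refine ⟨fun h => ⟨h 0, h 1, h 2, h 3⟩, fun ⟨h0, h1, h2, h3⟩ j => ?_⟩
  obtain rfl | rfl | rfl | rfl : j = 0 ∨ j = 1 ∨ j = 2 ∨ j = 3 := by
    revert j
    decide
  exacts [h0, h1, h2, h3]

theorem exists_zmod_four {p : ZMod 4 → Prop} : (∃ j, p j) ↔ p 0 ∨ p 1 ∨ p 2 ∨ p 3 := by
  rw [← not_iff_not]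
  simpa only [not_exists, not_or] using forall_zmod_four (p := fun j => ¬p j)

theorem sameCyclic_comp {k : ℕ} {α : Type*} (B : ZMod k → α) {σ : ZMod k → ZMod k}
    (hstep : ∀ j, σ (j + 1) = σ j + 1 ∨ σ (j + 1) = σ j - 1) (hback : ∀ j, σ (j + 2) ≠ σ j) :
    SameCyclic B (B ∘ σ) := by
  have hconst {f : ZMod k → ZMod k} (hf : Function.Periodic f 1) (j : ZMod k) :
      f j = f 0 := by
    obtain ⟨m, rfl⟩ := ZMod.intCast_surjective j
    simpa using hf.int_mul_eq m
  have hperiodic : Function.Periodic (fun j => σ (j + 1) - σ j) 1 := fun j => by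
    have hnext := hstep (j + 1)
    have hback := hback j
    simp only [add_assoc, one_add_one_eq_two] at hnext ⊢
    rcases hstep j with h | h <;> rcases hnext with h' | h' <;> simp_all
  have hdiff (j : ZMod k) : σ (j + 1) - σ j = σ (0 + 1) - σ 0 := hconst hperiodic j
  rcases hstep 0 with h | h
  · refine Or.inl ⟨σ 0, fun j => congrArg B ?_⟩
    have := hconst (f := fun j => σ j - j) (fun j => by linear_combination hdiff j + h) j
    linear_combination this
  · refine Or.inr ⟨σ 0, fun j => congrArg B ?_⟩
    have := hconst (f := fun j => σ j + j) (fun j => by linear_combination hdiff j + h) j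
    linear_combination this

namespace VertexFamily

variable {ι : Type*} [DecidableEq ι] {K : VertexFamily ι} {k : ℕ} {B C : ZMod k → ι} {q : ι}

/-- The combinatorial form of a `k`-belt, for `k ≥ 4`: a cyclic sequence of distinct facets in
which exactly the successive ones are adjacent. -/
structure IsCyclicBelt (K : VertexFamily ι) (B : ZMod k → ι) : Prop where
  injective : Function.Injective B
  mem_edges_iff : ∀ i j, i ≠ j → ({B i, B j} ∈ edges K ↔ j = i + 1 ∨ i = j + 1)

/-- The combinatorial form of the condition that `B` surrounds the facet `q`. -/
structure IsRingAround (K : VertexFamily ι) (B : ZMod k → ι) (q : ι) : Prop where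
  injective : Function.Injective B
  mem_edges_iff : ∀ x, {q, x} ∈ edges K ↔ ∃ j, B j = x
  mem : ∀ j, {q, B j, B (j + 1)} ∈ K

theorem isCyclicBelt_of_four {B : ZMod 4 → ι} (hinj : Function.Injective B)
    (hedge : ∀ j, {B j, B (j + 1)} ∈ edges K) (hdiag : ∀ j, {B j, B (j + 2)} ∉ edges K) :
    IsCyclicBelt K B where
  injective := hinj
  mem_edges_iff i j hij := by
    have hcases : ∀ i j : ZMod 4, i ≠ j → j = i + 1 ∨ i = j + 1 ∨
        (j = i + 2 ∧ ¬(j = i + 1 ∨ i = j + 1)) := by decide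
    rcases hcases i j hij with rfl | rfl | ⟨rfl, hnot⟩
    · exact iff_of_true (hedge i) (Or.inl rfl)
    · exact iff_of_true (pair_comm (B j) _ ▸ hedge j) (Or.inr rfl)
    · exact iff_of_false (hdiag i) hnot

theorem HasNoThreeBelt.exists_isCyclicBelt_isRingAround (hF : HasNoThreeBelt K)
    (hK : IsSimpleSphere K) (hq : degree K q = 4) :
    ∃ B : ZMod 4 → ι, IsCyclicBelt K B ∧ IsRingAround K B q := by
  obtain ⟨a, b, c, d, hn, hlink, hac, hbd⟩ := hF.exists_link_eq_fourCycle hK hq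
  let B : ZMod 4 → ι := ![a, b, c, d]
  have hinj : Function.Injective B := List.nodup_ofFn.1 hn
  have hring : IsRingAround K B q := by
    refine ⟨hinj, fun x => ?_, fun j => ?_⟩
    · rw [mem_edges_iff_of_link_eq_fourCycle hlink, exists_zmod_four]
      change x ∈ _ ↔ a = x ∨ b = x ∨ c = x ∨ d = x
      simp only [mem_insert, mem_singleton, eq_comm]
    · have : {B j, B (j + 1)} ∈ link K q := by
        rw [hlink]
        revert j
        rw [forall_zmod_four]
        change {a, b} ∈ _ ∧ {b, c} ∈ _ ∧ {c, d} ∈ _ ∧ {d, a} ∈ _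
        simp [fourCycle]
      exact (VertexFamily.mem_link.1 this).2
  refine ⟨B, isCyclicBelt_of_four hinj (fun j => ?_) ?_, hring⟩
  · exact mem_edges_of_subset (hring.mem j) (subset_insert _ _)
      (card_pair (hinj.ne (by revert j; decide)))
  · rw [forall_zmod_four]
    exact ⟨hac, hbd, pair_comm a c ▸ hac, pair_comm b d ▸ hbd⟩

theorem IsCyclicBelt.exists_quadrangle [Finite ι] {B : ZMod 4 → ι} (hB : IsCyclicBelt K B)
    (hK : IsSimpleSphere K) (hP : PentHex K) : ∃ q, degree K q = 4 ∧ ∀ j, {q, B j} ∈ edges K := by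
  have hedge {i j : ZMod 4} (h : i ≠ j ∧ (j = i + 1 ∨ i = j + 1)) : {B i, B j} ∈ edges K :=
    (hB.mem_edges_iff i j h.1).2 h.2
  have hdiag {i j : ZMod 4} (h : i ≠ j ∧ ¬(j = i + 1 ∨ i = j + 1)) : {B i, B j} ∉ edges K :=
    mt (hB.mem_edges_iff i j h.1).1 h.2
  have : Nonempty ι := ⟨B 0⟩
  obtain ⟨q, hq, hadj⟩ := exists_quadrangle_of_fourCycle (a := B 0) (b := B 1) (c := B 2)
    (d := B 3) hK hP (List.nodup_ofFn.2 hB.injective)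
    (by simp only [fourCycle, insert_subset_iff, singleton_subset_iff]
        exact ⟨hedge (by decide), hedge (by decide), hedge (by decide), hedge (by decide)⟩)
    (hdiag (by decide)) (hdiag (by decide))
  refine ⟨q, hq, forall_zmod_four.2 ?_⟩
  simp [hadj]

theorem IsCyclicBelt.sameCyclic (hB : IsCyclicBelt K B) (hC : IsCyclicBelt K C)
    (hk : (2 : ZMod k) ≠ 0) (hsub : ∀ j, ∃ i, B i = C j) : SameCyclic B C := by
  choose σ hσ using hsub
  obtain rfl : B ∘ σ = C := funext hσ
  have hinj : Function.Injective σ := hC.injective.of_comp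
  have hone : (1 : ZMod k) ≠ 0 := fun h => hk (by rw [← one_add_one_eq_two, h, add_zero])
  refine sameCyclic_comp B (fun j => ?_) fun j => hinj.ne (by simpa using hk)
  have hne : j ≠ j + 1 := by simpa using hone
  have hedge := (hC.mem_edges_iff j (j + 1) hne).2 (Or.inl rfl)
  exact ((hB.mem_edges_iff _ _ (hinj.ne hne)).1 hedge).imp_right fun h => eq_sub_of_add_eq h.symm

end VertexFamily

namespace ConvexPolytope

open VertexFamily

variable {P : ConvexPolytope 3} {k : ℕ} {B : ZMod k → Fin P.m} {q : Fin P.m}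

theorem IsBelt.isCyclicBelt (hB : P.IsBelt B) (hP : P.IsSimple) :
    IsCyclicBelt P.vertexFamily B := by
  obtain ⟨hloop, -, hmeet⟩ := hB
  have hsucc (j : ZMod k) : B j ≠ B (j + 1) := fun h => by
    simpa [← h] using card_of_mem_edges (hP.isEdge_facet_inter_iff.1 (hloop j))
  have hinj : Function.Injective B := by
    intro i j hij
    by_contra hne
    rcases (hmeet i j hne).1 (by rw [hij, Set.inter_self]; exact facet_nonempty _) with rfl | rfl
    exacts [hsucc _ hij, hsucc _ hij.symm]
  exact ⟨hinj, fun i j hij => by rw [← hmeet i j hij, facet_inter_nonempty_iff (hinj.ne hij)]⟩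

theorem isBelt_of_isCyclicBelt (hP : P.IsSimple) (hk : 4 ≤ k)
    (hB : IsCyclicBelt P.vertexFamily B) : P.IsBelt B := by
  have hmeet (i j : ZMod k) (hij : i ≠ j) :
      (P.facet (B i) ∩ P.facet (B j)).Nonempty ↔ j = i + 1 ∨ i = j + 1 := by
    rw [facet_inter_nonempty_iff (hB.injective.ne hij), hB.mem_edges_iff i j hij]
  have hne {m : ℕ} (hm : 0 < m) (hmk : m < 4) : (m : ZMod k) ≠ 0 := by
    rw [Ne, ZMod.natCast_eq_zero_iff]
    exact fun h => absurd (Nat.le_of_dvd hm h) (by omega)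
  have h1 : (1 : ZMod k) ≠ 0 := by simpa using hne (m := 1)
  have h2 : (2 : ZMod k) ≠ 0 := by simpa using hne (m := 2)
  have h3 : (3 : ZMod k) ≠ 0 := by simpa using hne (m := 3)
  refine ⟨fun j => ?_, ?_, hmeet⟩
  · rw [hP.isEdge_facet_inter_iff, hB.mem_edges_iff _ _ (by simpa using h1)]
    exact Or.inl rfl
  · by_contra hcommon
    obtain ⟨x, hx⟩ := Set.nonempty_iff_ne_empty.2 hcommon
    rw [Set.mem_iInter] at hx
    rcases (hmeet 0 2 h2.symm).1 ⟨x, hx 0, hx 2⟩ with h | h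
    · exact h1 (by linear_combination h)
    · exact h3 (by linear_combination -h)

theorem surrounds_of_isRingAround (hP : P.IsSimple) (hB : IsRingAround P.vertexFamily B q) :
    P.Surrounds B q := by
  have hedge (j : ZMod k) : {q, B j} ∈ edges P.vertexFamily := (hB.mem_edges_iff _).2 ⟨j, rfl⟩
  simp only [Surrounds, facet_inter_facet]
  refine ⟨fun i j hij => ?_, ?_, fun j => ?_⟩
  · have hpair := hP.injOn_face (hedge i) (hedge j) hij
    have hmem : B i ∈ ({q, B j} : Finset (Fin P.m)) := hpair ▸ mem_insert_of_mem (by simp)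
    rcases mem_insert.1 hmem with hi | hi
    · simpa [hi] using card_of_mem_edges (hedge i)
    · exact hB.injective (mem_singleton.1 hi)
  · rw [hP.edgesOf_eq_image]
    ext G
    constructor
    · rintro ⟨j, rfl⟩
      exact ⟨_, mem_coe.2 (mem_filter.2 ⟨hedge j, mem_insert_self _ _⟩), rfl⟩
    · rintro ⟨e, he, rfl⟩
      obtain ⟨he, hqe⟩ := mem_filter.1 (mem_coe.1 he)
      obtain ⟨x, hx⟩ := card_eq_one.1
        (show #(e.erase q) = 1 by rw [card_erase_of_mem hqe, card_of_mem_edges he])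
      obtain rfl : {q, x} = e := by rw [← insert_erase hqe, hx]
      obtain ⟨j, rfl⟩ := (hB.mem_edges_iff x).1 he
      exact ⟨j, rfl⟩
  · obtain ⟨x, hx, hsub⟩ := face_nonempty_iff.2 ⟨_, hB.mem j, Subset.rfl⟩
    simp only [insert_subset_iff, singleton_subset_iff] at hsub
    exact ⟨x, ⟨hx, by simp [insert_subset_iff, hsub]⟩, mem_facet.2 ⟨hx, hsub.2.2⟩⟩

theorem PentHexWithException.pentHex (hE : P.PentHexWithException) (hP : P.IsSimple) :
    PentHex P.vertexFamily := by
  simp only [PentHexWithException, hP.isGon_iff] at hE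
  exact ⟨fun i => by have := hE.1 i; omega, fun i => by have := hE.1 i; omega, hE.2⟩

theorem IsFullerene.not_isGon_four (hP : P.IsFullerene) (i : Fin P.m) : ¬P.IsGon 4 i := by
  have := hP.2 i
  simp only [IsGon] at this ⊢
  omega

theorem IsFullerene.pentHexWithException (hP : P.IsFullerene) : P.PentHexWithException := by
  refine ⟨fun i => by have := hP.2 i; tauto, fun i j hi _ => ?_⟩
  have := hP.2 i
  simp only [IsGon] at this hi
  omega

theorem exists_isGon_four_of_isBelt (hP : P.IsSimple) (hE : P.PentHexWithException)
    {B : ZMod 4 → Fin P.m} (hB : P.IsBelt B) :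
    ∃ q, P.IsGon 4 q ∧ ∀ j, {q, B j} ∈ edges P.vertexFamily := by
  simp only [hP.isGon_iff]
  exact (hB.isCyclicBelt hP).exists_quadrangle hP.isSimpleSphere (hE.pentHex hP)

theorem exists_unique_belt (hP : P.IsSimple) (hE : P.PentHexWithException) (hq : P.IsGon 4 q) :
    ∃ B : ZMod 4 → Fin P.m, P.IsBelt B ∧ P.Surrounds B q ∧
      ∀ C : ZMod 4 → Fin P.m, P.IsBelt C → SameCyclic B C := by
  have hK := hP.isSimpleSphere
  have : Nonempty (Fin P.m) := ⟨q⟩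
  obtain ⟨B, hB, hring⟩ := ((hE.pentHex hP).hasNoThreeBelt hK).exists_isCyclicBelt_isRingAround hK
    (hP.isGon_iff.1 hq)
  refine ⟨B, isBelt_of_isCyclicBelt hP le_rfl hB, surrounds_of_isRingAround hP hring,
    fun C hC => ?_⟩
  obtain ⟨q', hq', hadj⟩ := exists_isGon_four_of_isBelt hP hE hC
  obtain rfl : q' = q := hE.2 q' q (Or.inl hq') (Or.inl hq)
  exact hB.sameCyclic (hC.isCyclicBelt hP) (by decide) fun j => (hring.mem_edges_iff _).1 (hadj j)

end ConvexPolytope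

theorem mainTheorem4 :
    (∀ P : ConvexPolytope 3, P.IsSimple → P.PentHexWithException →
      ((¬ ∃ i, P.IsGon 4 i) → ¬ ∃ B : ZMod 4 → Fin P.m, P.IsBelt B) ∧
      (∀ F : Fin P.m, P.IsGon 4 F →
        ∃ B : ZMod 4 → Fin P.m, P.IsBelt B ∧ P.Surrounds B F ∧
          ∀ C : ZMod 4 → Fin P.m, P.IsBelt C → SameCyclic B C)) ∧
    (∀ P : ConvexPolytope 3, P.IsFullerene → ¬ ∃ B : ZMod 4 → Fin P.m, P.IsBelt B) := by
  have hquad (P : ConvexPolytope 3) (hP : P.IsSimple) (hE : P.PentHexWithException)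
      (hno : ¬∃ i, P.IsGon 4 i) : ¬∃ B : ZMod 4 → Fin P.m, P.IsBelt B := fun ⟨_, hB⟩ =>
    have ⟨q, hq, _⟩ := ConvexPolytope.exists_isGon_four_of_isBelt hP hE hB
    hno ⟨q, hq⟩
  exact ⟨fun P hP hE => ⟨hquad P hP hE, fun _ => ConvexPolytope.exists_unique_belt hP hE⟩,
    fun P hP => hquad P hP.1 hP.pentHexWithException fun ⟨i, hi⟩ => hP.not_isGon_four i hi⟩
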